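/- \textbf{Proposition.} Let $d\ge 1$, let $\mathcal U$ be the uniform distribution on the unit sphere $\mathbb S^{d-1}\subset\mathbb R^d$, and for a probability measure $\rho$ on $\mathbb R^d$ and $\theta\in\mathbb S^{d-1}$ let $\rho^\theta$ be the pushforward of $\rho$ under $x\mapsto\langle x,\theta\rangle$. For a fixed target probability measure $\mu$ put $$\mathscr F(\sigma)=\frac d2\,SW_2^2(\sigma,\mu)=\frac d2\int_{\mathbb S^{d-1}}W_2^2(\sigma^\theta,\mu^\theta)\,\mathrm d\mathcal U(\theta),$$ where $W_2$ is the 2-Wasserstein distance on $\mathbb R$, and $$\nabla_{W_2}\mathscr F(\sigma)(x)=d\int_{\mathbb S^{d-1}}\theta\,\bigl(\langle x,\theta\rangle-T_{\sigma^\theta}^{\mu^\theta}(\langle x,\theta\rangle)\bigr)\,\mathrm d\mathcal U(\theta),$$ where $T_\alpha^\beta=F_\beta^{-1}\circ F_\alpha$ is the one-dimensional optimal transport map ($F_\alpha$ the cumulative distribution function of $\alpha$, $F_\beta^{-1}$ the quantile function of $\beta$). Write $\|v\|_\sigma^2=\int\|v\|^2\,\mathrm d\sigma$. Let $\nu$ be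 a probability measure on $\mathbb R^d$ with finite second moment, absolutely continuous with respect to Lebesgue measure, which satisfies a Poincaré inequality with constant $C_\nu>0$: $$\operatorname{Var}_\nu(f)\le C_\nu\,\|\nabla f\|_\nu^2\quad\text{for every } C^1 \text{ function } f:\mathbb R^d\to\mathbb R \text{ with } \|\nabla f\|_\nu^2<+\infty .$$ Let $m>0$ and $M$ be real numbers, and let $\mu$ and $\sigma$ be probability measures on $\mathbb R^d$ with $m\nu\le\mu\le M\nu$ and $m\nu\le\sigma\le M\nu$. Then $\mathscr F(\sigma)<+\infty$, the integral defining $\nabla_{W_2}\mathscr F(\sigma)(x)$ converges absolutely for $\sigma$-a.e. $x$ and $\nabla_{W_2}\mathscr F(\sigma)$ lies in $L^2(\sigma)$, and $$\mathscr F(\sigma)\le 2\sqrt{C_\nu}\,\frac Mm\,\bigl\|\nabla_{W_2}\mathscr F(\sigma)\bigr\|_\sigma .$$ In particular $\|\nabla_{W_2}\mathscr F(\sigma)\|_\sigma=0$ if and only if $\mathscr F(\sigma)=0$, if and only if $\sigma=\mu$: under these bounds the only critical point is $\mu$. -/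

import Mathlib

open MeasureTheory ProbabilityTheory
open scoped ENNReal

noncomputable section

namespace SlicedOT

/-- `ℝ^d` with its Euclidean norm and inner product. -/
abbrev Space (d : ℕ) : Type := EuclideanSpace ℝ (Fin d)

/-- The unit sphere `𝕊^{d-1}` of `ℝ^d`. -/
abbrev Sphere (d : ℕ) : Type := Metric.sphere (0 : Space d) 1

/-- The uniform probability distribution on `𝕊^{d-1}`: the normalized surface measure. -/
def uniformSphere (d : ℕ) : Measure (Sphere d) :=
  ((volume : Measure (Space d)).toSphere Set.univ)⁻¹ • (volume : Measure (Space d)).toSphere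

/-- The one-dimensional marginal `σ^θ = (π_θ)_♯ σ`, where `π_θ x = ⟨x, θ⟩`. -/
def proj {d : ℕ} (σ : Measure (Space d)) (θ : Sphere d) : Measure ℝ :=
  σ.map (fun x => inner ℝ x (θ : Space d))

/-- The squared 2-Wasserstein distance between two measures on the line: the infimum of the
quadratic transport cost over all couplings. -/
def W2sq (α β : Measure ℝ) : ℝ≥0∞ :=
  ⨅ (γ : Measure (ℝ × ℝ)) (_ : γ.map Prod.fst = α ∧ γ.map Prod.snd = β),
    ∫⁻ p, ‖p.1 - p.2‖ₑ ^ 2 ∂γ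

/-- The squared Sliced-Wasserstein distance. -/
def SW2sq {d : ℕ} (σ μ : Measure (Space d)) : ℝ≥0∞ :=
  ∫⁻ θ, W2sq (proj σ θ) (proj μ θ) ∂(uniformSphere d)

/-- The objective `F(σ) = (d / 2) SW_2^2(σ, μ)`. -/
def loss {d : ℕ} (μ σ : Measure (Space d)) : ℝ≥0∞ :=
  (d : ℝ≥0∞) / 2 * SW2sq σ μ

/-- The quantile function (generalized inverse of the cumulative distribution function). -/
def quantile (β : Measure ℝ) (u : ℝ) : ℝ :=
  sInf {t : ℝ | u ≤ cdf β t}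

/-- The one-dimensional optimal transport map `F_β⁻¹ ∘ F_α` from `α` to `β`. -/
def otMap (α β : Measure ℝ) (s : ℝ) : ℝ :=
  quantile β (cdf α s)

/-- The contribution `θ (Id - T_{σ^θ}^{μ^θ}) (π_θ x)` of the direction `θ` to the Wasserstein
gradient of the objective at `σ`. -/
def sliceGrad {d : ℕ} (μ σ : Measure (Space d)) (x : Space d) (θ : Sphere d) : Space d :=
  (inner ℝ x (θ : Space d) - otMap (proj σ θ) (proj μ θ) (inner ℝ x (θ : Space d))) •
    (θ : Space d)

/-- The Wasserstein gradient
`∇_{W_2} F(σ) = d ∫ θ (Id - T_{σ^θ}^{μ^θ}) ∘ π_θ dU(θ)` of the objective. -/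
def wassersteinGrad {d : ℕ} (μ σ : Measure (Space d)) (x : Space d) : Space d :=
  (d : ℝ) • ∫ θ, sliceGrad μ σ x θ ∂(uniformSphere d)

/-- The norm `‖v‖_σ = (∫ ‖v‖² dσ)^{1/2}` of a vector field, with values in `[0, ∞]`. -/
def fieldNorm {d : ℕ} (σ : Measure (Space d)) (v : Space d → Space d) : ℝ≥0∞ :=
  eLpNorm v 2 σ

/-- The Poincaré inequality with constant `C`: `Var_ν(f) ≤ C ‖∇f‖_ν²` for every continuously
differentiable `f` with `‖∇f‖_ν² < ∞`. The variance takes values in `[0, ∞]` and is infinite if `f`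
is not in `L²(ν)`. -/
def SatisfiesPoincare {d : ℕ} (ν : Measure (Space d)) (C : ℝ) : Prop :=
  ∀ f : Space d → ℝ, ContDiff ℝ 1 f → fieldNorm ν (gradient f) ^ 2 < ∞ →
    evariance f ν ≤ ENNReal.ofReal C * fieldNorm ν (gradient f) ^ 2

/-- The probability measures with finite second moment that are absolutely continuous with respect
to the Lebesgue measure. -/
structure IsP2ac {d : ℕ} (ν : Measure (Space d)) : Prop where
  isProbabilityMeasure : IsProbabilityMeasure ν
  secondMoment : ∫⁻ x, ‖x‖ₑ ^ 2 ∂ν < ∞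
  absolutelyContinuous : ν ≪ volume

/-- The probability measures `σ` with `m ν ≤ σ ≤ M ν`. -/
structure IsBoundedBy {d : ℕ} (ν : Measure (Space d)) (m M : ℝ) (σ : Measure (Space d)) :
    Prop where
  isProbabilityMeasure : IsProbabilityMeasure σ
  lower : ENNReal.ofReal m • ν ≤ σ
  upper : σ ≤ ENNReal.ofReal M • ν

end SlicedOT

end

/-! For a monotone `T` on the line, let `φ` be the primitive of `s - T s`. Monotonicity on the
segment between `T s` and `s` gives `φ(s) - φ(T s) ≥ (s - T s)² / 2`. For the map `T_θ` from `σ^θ`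
to `μ^θ`, integration bounds half of `W_2²(σ^θ, μ^θ)` by `∫ φ_θ dσ^θ - ∫ φ_θ dμ^θ`. Averaging over
`θ` gives one function `Φ` on `ℝ^d` with `d ∇Φ = ∇_{W_2} F(σ)` σ-a.e. and `F(σ) ≤ d (∫ Φ dσ - ∫ Φ
dμ)` (`loss_le_integral_averagePotential_sub`). Both means are close to the ν-mean of `Φ`:
Cauchy-Schwarz, the upper bounds by `M ν`, Poincaré and `m ν ≤ σ` control each deviation by `√(C M /
m) ‖∇Φ‖_σ` (`SatisfiesPoincare.ofReal_integral_sub_le`).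

Poincaré needs `Φ` to be C¹ with finite gradient norm, whereas a quantile map may jump. The Poincaré
inequality itself excludes jumps: tested on a smooth ramp from `a` to `b` in the direction `θ`, it
bounds `N a (1 - N b) (b - a)²` by `D (N b - N a)`, where `N` is the distribution function of `ν^θ`
and `D` does not depend on `θ` (`SatisfiesPoincare.exists_gap`). So the marginals have no gaps and
`T_θ` is continuous; with the comparison to `ν`, its displacement is bounded uniformly in `θ`
wherever the distribution function of `σ^θ` lies strictly between 0 and 1. On the remaining null set
the map is extended and truncated so that both properties hold on the whole line.

For the equivalences, a zero gradient forces zero loss by the inequality. Zero loss forces equal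
characteristic functions (`eq_of_SW2sq_eq_zero`), and at `σ = μ` the maps `T_θ` are a.e. the
identity. -/

noncomputable section

namespace SlicedOT

open Set Filter Topology

/-! ### Monotone rearrangement between comparable distribution functions -/

/-- `F` is a continuous cumulative distribution function comparable with `N`, and `N` satisfies the
isoperimetric-type inequality which a Poincaré inequality gives when tested on ramps. -/
structure ComparableCdf (N : ℝ → ℝ) (m M D : ℝ) (F : ℝ → ℝ) : Prop where
  mono : Monotone F
  cont : Continuous F
  nonneg : ∀ a, 0 ≤ F a
  le_one : ∀ a, F a ≤ 1
  atBot : Tendsto F atBot (𝓝 0)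
  atTop : Tendsto F atTop (𝓝 1)
  mul_sub_le : ∀ a b, a ≤ b → m * (N b - N a) ≤ F b - F a
  le_mul : ∀ a, F a ≤ M * N a
  mul_le : ∀ a, m * N a ≤ F a
  one_sub_le_mul : ∀ a, 1 - F a ≤ M * (1 - N a)
  mul_one_sub_le : ∀ a, m * (1 - N a) ≤ 1 - F a
  gap : ∀ a b, a < b → N a * (1 - N b) * (b - a) ^ 2 ≤ D * (N b - N a)

/-- The largest displacement of the monotone map between two comparable distributions. -/
def displacementBound (m M D : ℝ) : ℝ := √(D * (M / m) * (2 + M / m))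

/-- The monotone rearrangement from the distribution function `F` to `G`, extended to the left of
the support by the infimum of the support. -/
def rawTransport (F G : ℝ → ℝ) (s : ℝ) : ℝ := sInf {t | 0 < G t ∧ F s ≤ G t}

/-- The monotone rearrangement with displacement truncated at `K`. -/
def transport (K : ℝ) (F G : ℝ → ℝ) (s : ℝ) : ℝ := max (s - K) (min (s + K) (rawTransport F G s))

lemma displacementBound_nonneg (m M D : ℝ) : 0 ≤ displacementBound m M D := Real.sqrt_nonneg _

/-- Here `p`, `r`, `q` stand for the masses left of, inside and right of an interval of length `L`.
Comparability keeps `r` below a multiple of the smaller outer mass, so that mass cancels in `hgap`;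
the larger outer mass is bounded below because the total is 1. -/
lemma sq_le_of_gap {m M D p q r L : ℝ} (hm : 0 < m) (hM : 0 < M) (hD : 0 ≤ D) (hp : 0 < p)
    (hq : 0 < q) (hpr : m * (p + r) ≤ M * p) (hqr : m * (q + r) ≤ M * q)
    (hsum : p + q + r = 1) (hgap : p * q * L ^ 2 ≤ D * r) :
    L ^ 2 ≤ D * (M / m) * (2 + M / m) := by
  set κ := M / m with hκ
  have hκ0 : 0 < κ := div_pos hM hm
  have hMκ : M = κ * m := by rw [hκ]; field_simp
  have h1 : p + r ≤ κ * p := by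
    rw [hMκ] at hpr
    exact le_of_mul_le_mul_left (by linarith) hm
  have h2 : q + r ≤ κ * q := by
    rw [hMκ] at hqr
    exact le_of_mul_le_mul_left (by linarith) hm
  have key : ∀ p q : ℝ, 0 < p → p ≤ q → p + r ≤ κ * p → p + q + r = 1 →
      p * q * L ^ 2 ≤ D * r → L ^ 2 ≤ D * κ * (2 + κ) := by
    intro p q hp hpq h1 hsum hgap
    have h3 : q * L ^ 2 ≤ D * κ := by
      have : D * r ≤ D * (κ * p) := mul_le_mul_of_nonneg_left (by linarith) hD
      exact le_of_mul_le_mul_left (by linarith) hp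
    -- Since `p + r ≤ κ p ≤ κ q`, even the factor `1 + κ` would do.
    have h4 : 1 ≤ (2 + κ) * q := by nlinarith [mul_le_mul_of_nonneg_left hpq hκ0.le]
    calc L ^ 2 = 1 * L ^ 2 := (one_mul _).symm
      _ ≤ ((2 + κ) * q) * L ^ 2 := mul_le_mul_of_nonneg_right h4 (sq_nonneg L)
      _ = (2 + κ) * (q * L ^ 2) := by ring
      _ ≤ (2 + κ) * (D * κ) := mul_le_mul_of_nonneg_left h3 (by linarith)
      _ = D * κ * (2 + κ) := by ring
  rcases le_total p q with h | h
  · exact key p q hp h h1 hsum hgap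
  · exact key q p hq h h2 (by linarith) (by linarith)

section

variable {N F G : ℝ → ℝ} {m M D : ℝ}

/-- If `G` were flat on `[a, b]`, so would be `N`, and `gap` would leave no mass on one of the two
sides. -/
lemma ComparableCdf.lt_of_lt (hm : 0 < m) (hM : 0 < M) (hD : 0 ≤ D)
    (hG : ComparableCdf N m M D G) {a b : ℝ} (hab : a < b) (h0 : 0 < G a) (h1 : G b < 1) :
    G a < G b := by
  by_contra! h
  have h2 := hG.mul_sub_le a b hab.le
  have h3 : N b - N a ≤ 0 := by
    by_contra! h3
    nlinarith [mul_pos hm h3]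
  have h4 := hG.gap a b hab
  have h5 : 0 < N a := by
    by_contra! h5
    nlinarith [hG.le_mul a]
  have h6 : 0 < 1 - N b := by
    by_contra! h6
    nlinarith [hG.one_sub_le_mul b]
  have h7 : 0 < N a * (1 - N b) * (b - a) ^ 2 := by
    have := sub_pos.2 hab
    positivity
  nlinarith

lemma mem_transportSet_of_le (hG : Monotone G) {s t t' : ℝ} (h : 0 < G t ∧ F s ≤ G t)
    (htt : t ≤ t') : 0 < G t' ∧ F s ≤ G t' :=
  ⟨h.1.trans_le (hG htt), h.2.trans (hG htt)⟩

lemma ComparableCdf.eq_zero (hm : 0 < m) (hM : 0 < M) (hF : ComparableCdf N m M D F)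
    (hG : ComparableCdf N m M D G) {s : ℝ} (h : F s = 0) : G s = 0 := by
  have h1 := hF.mul_le s
  have h2 := hG.le_mul s
  have h3 := hG.nonneg s
  have : N s ≤ 0 := by
    by_contra! h4
    nlinarith [mul_pos hm h4]
  nlinarith

lemma ComparableCdf.eq_one (hm : 0 < m) (hM : 0 < M) (hF : ComparableCdf N m M D F)
    (hG : ComparableCdf N m M D G) {s : ℝ} (h : F s = 1) : G s = 1 := by
  have h1 := hF.mul_one_sub_le s
  have h2 := hG.one_sub_le_mul s
  have h3 := hG.le_one s
  have : 1 - N s ≤ 0 := by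
    by_contra! h4
    nlinarith [mul_pos hm h4]
  nlinarith

/-- At level 0 the limit of `G` at `-∞` gives no bound; instead comparability makes `G` vanish
wherever `F` does. The symmetric remark at level 1 serves nonemptiness. -/
lemma bddBelow_transportSet (hm : 0 < m) (hM : 0 < M) (hF : ComparableCdf N m M D F)
    (hG : ComparableCdf N m M D G) (s : ℝ) : BddBelow {t | 0 < G t ∧ F s ≤ G t} := by
  rcases (hF.nonneg s).eq_or_lt with h | h
  · have h0 := hF.eq_zero hm hM hG h.symm
    refine ⟨s, fun t ht => ?_⟩
    by_contra! hts
    exact (ht.1.trans_le (hG.mono hts.le)).ne' h0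
  · obtain ⟨l, hl⟩ := (hG.atBot.eventually_lt_const h).exists
    refine ⟨l, fun t ht => ?_⟩
    by_contra! hts
    exact absurd (ht.2.trans (hG.mono hts.le)) (not_le.2 hl)

lemma nonempty_transportSet (hm : 0 < m) (hM : 0 < M) (hF : ComparableCdf N m M D F)
    (hG : ComparableCdf N m M D G) (s : ℝ) : {t | 0 < G t ∧ F s ≤ G t}.Nonempty := by
  rcases (hF.le_one s).eq_or_lt with h | h
  · have h1 := hF.eq_one hm hM hG h
    exact ⟨s, by simp [h1], by simp [h1, h]⟩
  · obtain ⟨t, ht, ht0⟩ := ((hG.atTop.eventually_const_lt h).and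
      (hG.atTop.eventually_const_lt zero_lt_one)).exists
    exact ⟨t, ht0, ht.le⟩

lemma rawTransport_lt_iff (hm : 0 < m) (hM : 0 < M) (hF : ComparableCdf N m M D F)
    (hG : ComparableCdf N m M D G) {s t : ℝ} :
    rawTransport F G s < t ↔ ∃ t' < t, 0 < G t' ∧ F s ≤ G t' := by
  rw [rawTransport, csInf_lt_iff (bddBelow_transportSet hm hM hF hG s)
    (nonempty_transportSet hm hM hF hG s)]
  exact ⟨fun ⟨b, hb, h⟩ => ⟨b, h, hb⟩, fun ⟨b, h, hb⟩ => ⟨b, hb, h⟩⟩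

lemma rawTransport_le (hm : 0 < m) (hM : 0 < M) (hF : ComparableCdf N m M D F)
    (hG : ComparableCdf N m M D G) {s t : ℝ} (h0 : 0 < G t) (h : F s ≤ G t) :
    rawTransport F G s ≤ t :=
  csInf_le (bddBelow_transportSet hm hM hF hG s) ⟨h0, h⟩

lemma le_rawTransport (hm : 0 < m) (hM : 0 < M) (hF : ComparableCdf N m M D F)
    (hG : ComparableCdf N m M D G) {s t : ℝ} (h : G t = 0 ∨ G t < F s) :
    t ≤ rawTransport F G s := by
  refine le_csInf (nonempty_transportSet hm hM hF hG s) fun t' ht' => ?_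
  by_contra! hlt
  have := hG.mono hlt.le
  rcases h with h | h
  · linarith [ht'.1]
  · linarith [ht'.2]

/-- Galois connection between the rearrangement and the distribution functions. -/
lemma rawTransport_le_iff (hm : 0 < m) (hM : 0 < M) (hF : ComparableCdf N m M D F)
    (hG : ComparableCdf N m M D G) {s t : ℝ} (h0 : 0 < F s) :
    rawTransport F G s ≤ t ↔ F s ≤ G t := by
  refine ⟨fun h => ?_, fun h => rawTransport_le hm hM hF hG (h0.trans_le h) h⟩
  have h1 : ∀ t' > t, F s ≤ G t' := fun t' ht' => by
    obtain ⟨u, hu, -, hu'⟩ := (rawTransport_lt_iff hm hM hF hG).1 (h.trans_lt ht')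
    exact hu'.trans (hG.mono hu.le)
  exact ge_of_tendsto (hG.cont.continuousAt.mono_left nhdsWithin_le_nhds : Tendsto G (𝓝[>] t) _)
    (eventually_nhdsWithin_of_forall h1)

lemma apply_rawTransport (hm : 0 < m) (hM : 0 < M) (hF : ComparableCdf N m M D F)
    (hG : ComparableCdf N m M D G) {s : ℝ} (h0 : 0 < F s) : G (rawTransport F G s) = F s := by
  refine le_antisymm ?_ ((rawTransport_le_iff hm hM hF hG h0).1 le_rfl)
  have h1 : ∀ t < rawTransport F G s, G t ≤ F s := fun t ht => by
    by_contra! h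
    exact ht.not_ge ((rawTransport_le_iff hm hM hF hG h0).2 h.le)
  exact le_of_tendsto (hG.cont.continuousAt.mono_left nhdsWithin_le_nhds :
    Tendsto G (𝓝[<] (rawTransport F G s)) _) (eventually_nhdsWithin_of_forall h1)

lemma monotone_rawTransport (hm : 0 < m) (hM : 0 < M) (hF : ComparableCdf N m M D F)
    (hG : ComparableCdf N m M D G) : Monotone (rawTransport F G) := fun s s' hs =>
  csInf_le_csInf (bddBelow_transportSet hm hM hF hG s) (nonempty_transportSet hm hM hF hG s')
    fun _ ht => ⟨ht.1, (hF.mono hs).trans ht.2⟩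

/-- Continuity of `F` gives the lower bound near `s`. The upper bound needs strict increase of `G`,
since a flat piece of `G` is a jump of its inverse. -/
lemma continuous_rawTransport (hm : 0 < m) (hM : 0 < M) (hD : 0 ≤ D)
    (hF : ComparableCdf N m M D F) (hG : ComparableCdf N m M D G) :
    Continuous (rawTransport F G) := by
  refine continuous_iff_continuousAt.2 fun s => tendsto_order.2 ⟨fun t ht => ?_, fun t ht => ?_⟩
  · obtain ⟨t', ht, ht'⟩ := exists_between ht
    have h : G t' = 0 ∨ G t' < F s := by
      by_contra! h
      exact ht'.not_ge (rawTransport_le hm hM hF hG ((hG.nonneg t').lt_of_ne' h.1) h.2)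
    rcases h with h | h
    · exact Eventually.of_forall fun s' => ht.trans_le (le_rawTransport hm hM hF hG (.inl h))
    · filter_upwards [hF.cont.continuousAt.eventually_const_lt h] with s' hs'
      exact ht.trans_le (le_rawTransport hm hM hF hG (.inr hs'))
  · obtain ⟨t', ht', h0, h⟩ := (rawTransport_lt_iff hm hM hF hG).1 ht
    obtain ⟨t'', h1, h2⟩ := exists_between ht'
    -- Strict increase holds only below level 1; once `G` reaches 1 at `t''`, that point bounds
    -- every value of the rearrangement.
    rcases (hG.le_one t'').eq_or_lt with h3 | h3
    · exact Eventually.of_forall fun s' => (rawTransport_le hm hM hF hG (by rw [h3]; simp)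
        (by rw [h3]; exact hF.le_one s')).trans_lt h2
    · have h4 := hG.lt_of_lt hm hM hD h1 h0 h3
      filter_upwards [hF.cont.continuousAt.eventually_lt_const (h.trans_lt h4)] with s' hs'
      exact (rawTransport_le hm hM hF hG (h0.trans h4) hs'.le).trans_lt h2

lemma abs_rawTransport_sub_le (hm : 0 < m) (hM : 0 < M) (hD : 0 ≤ D)
    (hF : ComparableCdf N m M D F) (hG : ComparableCdf N m M D G) {s : ℝ} (h0 : 0 < F s)
    (h1 : F s < 1) : |s - rawTransport F G s| ≤ displacementBound m M D := by
  have hT := apply_rawTransport hm hM hF hG h0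
  set t := rawTransport F G s
  -- Stated for a generic pair so that displacements to the right and to the left are the same case
  -- with `F` and `G` exchanged.
  have key : ∀ {F G : ℝ → ℝ}, ComparableCdf N m M D F → ComparableCdf N m M D G → ∀ {a b : ℝ},
      a < b → F a = G b → 0 < F a → F a < 1 → |a - b| ≤ displacementBound m M D := by
    intro F G hF hG a b hab hFG h0 h1
    refine Real.abs_le_sqrt ?_
    have hp : 0 < N a := by
      by_contra! h5
      nlinarith [hF.le_mul a]
    have hq : 0 < 1 - N b := by
      by_contra! h6
      nlinarith [hG.one_sub_le_mul b]
    refine sq_le_of_gap (p := N a) (q := 1 - N b) (r := N b - N a) hm hM hD hp hq ?_ ?_ ?_ ?_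
    -- `m N(b) ≤ G(b) = F(a) ≤ M N(a)`, and likewise for the upper tails.
    · linarith [hG.mul_le b, hF.le_mul a]
    · linarith [hF.mul_one_sub_le a, hG.one_sub_le_mul b]
    · ring
    · have := hG.gap a b hab
      linarith
  rcases lt_trichotomy s t with h | h | h
  · exact key hF hG h hT.symm h0 h1
  · rw [h, sub_self, abs_zero]
    exact displacementBound_nonneg _ _ _
  · rw [abs_sub_comm]
    exact key hG hF h hT (by rwa [hT]) (by rwa [hT])

lemma rawTransport_self (hm : 0 < m) (hM : 0 < M) (hD : 0 ≤ D)
    (hF : ComparableCdf N m M D F) {s : ℝ} (h0 : 0 < F s) (h1 : F s < 1) :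
    rawTransport F F s = s := by
  refine le_antisymm (rawTransport_le hm hM hF hF h0 le_rfl) ?_
  by_contra! h
  have h2 := apply_rawTransport hm hM hF hF h0
  exact (hF.lt_of_lt hm hM hD h (by rwa [h2]) h1).ne h2

lemma transport_eq_rawTransport (hm : 0 < m) (hM : 0 < M) (hD : 0 ≤ D)
    (hF : ComparableCdf N m M D F) (hG : ComparableCdf N m M D G) {s : ℝ} (h0 : 0 < F s)
    (h1 : F s < 1) : transport (displacementBound m M D) F G s = rawTransport F G s := by
  have := abs_le.1 (abs_rawTransport_sub_le hm hM hD hF hG h0 h1)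
  rw [transport, min_eq_right (by linarith), max_eq_right (by linarith)]

lemma abs_sub_transport_le {K : ℝ} (hK : 0 ≤ K) (F G : ℝ → ℝ) (s : ℝ) :
    |s - transport K F G s| ≤ K := by
  have h1 : s - K ≤ transport K F G s := le_max_left _ _
  have h2 : transport K F G s ≤ s + K := max_le (by linarith) (min_le_left _ _)
  exact abs_le.2 ⟨by linarith, by linarith⟩

lemma monotone_transport (K : ℝ) (hm : 0 < m) (hM : 0 < M) (hF : ComparableCdf N m M D F)
    (hG : ComparableCdf N m M D G) : Monotone (transport K F G) := fun _ _ h =>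
  max_le_max (by linarith) (min_le_min (by linarith) (monotone_rawTransport hm hM hF hG h))

lemma continuous_transport (K : ℝ) (hm : 0 < m) (hM : 0 < M) (hD : 0 ≤ D)
    (hF : ComparableCdf N m M D F) (hG : ComparableCdf N m M D G) :
    Continuous (transport K F G) := by
  have := continuous_rawTransport hm hM hD hF hG
  unfold transport
  fun_prop

end

/-! ### Potentials of monotone maps -/

/-- The primitive of `s - T s` that vanishes at `0`. -/
def potential (T : ℝ → ℝ) (s : ℝ) : ℝ := s * ∫ u in (0 : ℝ)..1, (u * s - T (u * s))

lemma potential_eq_integral (T : ℝ → ℝ) (s : ℝ) :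
    potential T s = ∫ r in (0 : ℝ)..s, (r - T r) := by
  have := intervalIntegral.smul_integral_comp_mul_right (a := 0) (b := 1)
    (fun r => r - T r) s
  simpa [potential] using this

lemma hasDerivAt_potential {T : ℝ → ℝ} (hT : Continuous T) (s : ℝ) :
    HasDerivAt (potential T) (s - T s) s := by
  rw [funext (potential_eq_integral T)]
  have h : Continuous fun r => r - T r := by fun_prop
  exact intervalIntegral.integral_hasDerivAt_right (h.intervalIntegrable _ _)
    h.stronglyMeasurable.stronglyMeasurableAtFilter h.continuousAt

lemma abs_potential_le {T : ℝ → ℝ} {K : ℝ} (hT : ∀ s, |s - T s| ≤ K) (s : ℝ) :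
    |potential T s| ≤ K * |s| := by
  rw [potential_eq_integral]
  simpa using intervalIntegral.norm_integral_le_of_norm_le_const (a := 0) (b := s)
    (f := fun r => r - T r) (C := K) fun r _ => hT r

/-- The cost of the displacement by a monotone map is bounded by the decrease of the potential. -/
lemma sq_sub_div_two_le_potential_sub {T : ℝ → ℝ} (hT : Continuous T) (hmono : Monotone T)
    (s : ℝ) : (s - T s) ^ 2 / 2 ≤ potential T s - potential T (T s) := by
  have h : Continuous fun r => r - T r := by fun_prop
  rw [potential_eq_integral, potential_eq_integral,
    intervalIntegral.integral_interval_sub_left (h.intervalIntegrable _ _)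
      (h.intervalIntegrable _ _)]
  have h2 : ∫ r in (T s)..s, (r - T s) = (s - T s) ^ 2 / 2 := by
    rw [intervalIntegral.integral_sub (by simp) (by simp)]
    simp
    ring
  have h3 : Continuous fun r => r - T s := by fun_prop
  rw [← h2]
  rcases le_total (T s) s with hle | hle
  · exact intervalIntegral.integral_mono_on hle (h3.intervalIntegrable _ _)
      (h.intervalIntegrable _ _) fun r hr => by linarith [hmono hr.2]
  · rw [intervalIntegral.integral_symm, intervalIntegral.integral_symm s]
    exact neg_le_neg (intervalIntegral.integral_mono_on hle (h.intervalIntegrable _ _)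
      (h3.intervalIntegrable _ _) fun r hr => by linarith [hmono hr.1])

lemma sq_lintegral_enorm_le {Ω E : Type*} [MeasurableSpace Ω] [NormedAddCommGroup E]
    {P : Measure Ω} [IsProbabilityMeasure P] {f : Ω → E} (hf : AEStronglyMeasurable f P) :
    (∫⁻ x, ‖f x‖ₑ ∂P) ^ 2 ≤ ∫⁻ x, ‖f x‖ₑ ^ 2 ∂P := by
  have h1 := eLpNorm_le_eLpNorm_of_exponent_le (p := 1) (q := 2) (by norm_num) hf
  rw [eLpNorm_one_eq_lintegral_enorm] at h1
  have h2 := eLpNorm_nnreal_pow_eq_lintegral (f := f) (μ := P) (p := 2) (by norm_num)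
  have h3 : ((2 : NNReal) : ℝ) = ((2 : ℕ) : ℝ) := by norm_num
  simp only [h3, ENNReal.rpow_natCast] at h2
  rw [← h2]
  exact pow_le_pow_left' h1 2

/-! ### Measures on the line: distribution functions, transport and characteristic functions -/

section RealLine

variable {α β n : Measure ℝ}

lemma continuous_cdf (α : Measure ℝ) [IsProbabilityMeasure α] [NullSingletonClass α] :
    Continuous (cdf α) := by
  refine continuous_iff_continuousAt.2 fun a => continuousAt_iff_continuous_left'_right'.2 ⟨?_, ?_⟩
  · rw [(monotone_cdf α).continuousWithinAt_Iio_iff_leftLim_eq]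
    have h := (cdf α).measure_singleton a
    rw [measure_cdf, measure_singleton] at h
    have h1 := ENNReal.ofReal_eq_zero.1 h.symm
    have h2 := (monotone_cdf α).leftLim_le (le_refl a)
    linarith
  · exact ((cdf α).right_continuous a).mono Ioi_subset_Ici_self

lemma cdf_sub_cdf [IsProbabilityMeasure α] {a b : ℝ} (hab : a ≤ b) :
    cdf α b - cdf α a = α.real (Ioc a b) := by
  rw [cdf_eq_real, cdf_eq_real, ← measureReal_sdiff (Iic_subset_Iic.2 hab) measurableSet_Iic]
  congr 1
  ext x
  simp [and_comm]

lemma one_sub_cdf [IsProbabilityMeasure α] (a : ℝ) : 1 - cdf α a = α.real (Ioi a) := by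
  rw [cdf_eq_real, ← probReal_compl_eq_one_sub measurableSet_Iic, compl_Iic]

/-- The distribution functions of comparable measures are comparable. -/
lemma comparableCdf_cdf [IsProbabilityMeasure α] [IsProbabilityMeasure n] [NullSingletonClass α]
    {m M D : ℝ} (hm : 0 ≤ m) (hM : 0 ≤ M) (hl : ENNReal.ofReal m • n ≤ α)
    (hu : α ≤ ENNReal.ofReal M • n)
    (gap : ∀ a b, a < b → cdf n a * (1 - cdf n b) * (b - a) ^ 2 ≤ D * (cdf n b - cdf n a)) :
    ComparableCdf (cdf n) m M D (cdf α) := by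
  have h1 : ∀ s, m * n.real s ≤ α.real s := fun s => by
    have := ENNReal.toReal_mono (measure_ne_top α s) (hl s)
    simpa [measureReal_def, ENNReal.toReal_mul, hm] using this
  have h2 : ∀ s, α.real s ≤ M * n.real s := fun s => by
    have := ENNReal.toReal_mono (by simp [ENNReal.mul_eq_top]) (hu s)
    simpa [measureReal_def, ENNReal.toReal_mul, hM] using this
  refine ⟨monotone_cdf α, continuous_cdf α, cdf_nonneg α, cdf_le_one α, tendsto_cdf_atBot α,
    tendsto_cdf_atTop α, fun a b hab => ?_, fun a => ?_, fun a => ?_, fun a => ?_, fun a => ?_, gap⟩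
  · rw [cdf_sub_cdf hab, cdf_sub_cdf hab]
    exact h1 _
  · rw [cdf_eq_real, cdf_eq_real]
    exact h2 _
  · rw [cdf_eq_real, cdf_eq_real]
    exact h1 _
  · rw [one_sub_cdf, one_sub_cdf]
    exact h2 _
  · rw [one_sub_cdf, one_sub_cdf]
    exact h1 _

/-- The probability integral transform. -/
lemma measure_cdf_le [IsProbabilityMeasure α] [NullSingletonClass α] {u : ℝ} (h0 : 0 ≤ u)
    (h1 : u < 1) : α {s | cdf α s ≤ u} = ENNReal.ofReal u := by
  have hc := continuous_cdf α
  have hex : ∀ v, 0 < v → v < 1 → ∃ s, cdf α s = v := fun v hv hv' => by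
    obtain ⟨a, ha⟩ := ((tendsto_cdf_atBot α).eventually_lt_const hv).exists
    obtain ⟨b, hb⟩ := ((tendsto_cdf_atTop α).eventually_const_lt hv').exists
    exact mem_range_of_exists_le_of_exists_ge hc ⟨a, ha.le⟩ ⟨b, hb.le⟩
  refine le_antisymm ?_ ?_
  -- A value `v > u` is attained at some `s`, and the set lies in `Iic s`, of mass `v`; then `v`
  -- decreases to `u`.
  · have h : ∀ v ∈ Ioo u 1, α {s | cdf α s ≤ u} ≤ ENNReal.ofReal v := fun v hv => by
      obtain ⟨s, rfl⟩ := hex v (h0.trans_lt hv.1) hv.2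
      rw [ofReal_cdf]
      refine measure_mono fun t ht => ?_
      refine (le_of_not_gt fun (hst : s < t) => ?_ : t ≤ s)
      exact absurd (hv.1.trans_le (monotone_cdf α hst.le)) (not_lt.2 ht)
    have ht : Tendsto ENNReal.ofReal (𝓝[>] u) (𝓝 (ENNReal.ofReal u)) :=
      ENNReal.continuous_ofReal.continuousAt.mono_left nhdsWithin_le_nhds
    refine ge_of_tendsto ht ?_
    filter_upwards [Ioo_mem_nhdsGT h1] with v hv using h v hv
  · rcases h0.eq_or_lt with rfl | h0
    · simp
    · obtain ⟨s, rfl⟩ := hex u h0 h1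
      rw [ofReal_cdf]
      exact measure_mono fun t ht => monotone_cdf α ht

lemma ae_cdf_mem_Ioo (α : Measure ℝ) [IsProbabilityMeasure α] [NullSingletonClass α] :
    ∀ᵐ s ∂α, cdf α s ∈ Ioo 0 1 := by
  have h0 : ∀ᵐ s ∂α, 0 < cdf α s := by
    rw [ae_iff]
    simpa using measure_cdf_le (α := α) le_rfl zero_lt_one
  have h1 : ∀ᵐ s ∂α, cdf α s < 1 := by
    have hms : MeasurableSet {s | cdf α s < 1} :=
      measurableSet_lt (continuous_cdf α).measurable measurable_const
    refine (prob_compl_eq_zero_iff hms).2 (le_antisymm prob_le_one ?_)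
    have ht : Tendsto ENNReal.ofReal (𝓝[<] 1) (𝓝 1) := by
      have : Tendsto ENNReal.ofReal (𝓝[<] 1) (𝓝 (ENNReal.ofReal 1)) :=
        ENNReal.continuous_ofReal.continuousAt.mono_left nhdsWithin_le_nhds
      simpa using this
    refine le_of_tendsto ht ?_
    filter_upwards [Ioo_mem_nhdsLT (zero_lt_one' ℝ)] with u hu
    rw [← measure_cdf_le (α := α) hu.1.le hu.2]
    exact measure_mono fun t ht => lt_of_le_of_lt ht hu.2
  filter_upwards [h0, h1] with s h0 h1 using ⟨h0, h1⟩

variable {m M D : ℝ} {N : ℝ → ℝ}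

/-- The monotone rearrangement pushes `α` forward to `β`. -/
lemma map_transport [IsProbabilityMeasure α] [NullSingletonClass α] [IsProbabilityMeasure β]
    (hm : 0 < m) (hM : 0 < M) (hD : 0 ≤ D)
    (hF : ComparableCdf N m M D (cdf α)) (hG : ComparableCdf N m M D (cdf β)) :
    α.map (transport (displacementBound m M D) (cdf α) (cdf β)) = β := by
  have hT := (continuous_transport (displacementBound m M D) hm hM hD hF hG).measurable
  have : IsProbabilityMeasure (α.map (transport (displacementBound m M D) (cdf α) (cdf β))) :=
    Measure.isProbabilityMeasure_map hT.aemeasurable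
  refine Measure.ext_of_Iic _ _ fun t => ?_
  rw [Measure.map_apply hT measurableSet_Iic, ← ofReal_cdf]
  -- By the Galois connection, the preimage of `Iic t` is a.e. a sublevel set of the distribution
  -- function, whose mass the probability integral transform gives.
  have h : α (transport (displacementBound m M D) (cdf α) (cdf β) ⁻¹' Iic t) =
      α {s | cdf α s ≤ cdf β t} := by
    refine measure_congr ?_
    filter_upwards [ae_cdf_mem_Ioo α] with s hs
    refine propext ?_
    change transport _ _ _ s ≤ t ↔ cdf α s ≤ cdf β t
    rw [transport_eq_rawTransport hm hM hD hF hG hs.1 hs.2, rawTransport_le_iff hm hM hF hG hs.1]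
  rw [h]
  rcases (cdf_le_one β t).eq_or_lt with h1 | h1
  · simp [h1, cdf_le_one]
  · exact measure_cdf_le (cdf_nonneg β t) h1

/-- At a positive level the condition `0 < G t` is automatic. At level 0 the quantile is the infimum
of all of `ℝ`, a default value, so the hypothesis is needed. -/
lemma otMap_eq_rawTransport {α β : Measure ℝ} {s : ℝ} (h : 0 < cdf α s) :
    otMap α β s = rawTransport (cdf α) (cdf β) s := by
  unfold otMap quantile rawTransport
  congr 1
  ext t
  exact ⟨fun ht => ⟨h.trans_le ht, ht⟩, fun ht => ht.2⟩

lemma W2sq_le_lintegral_map {α β : Measure ℝ} {T : ℝ → ℝ} (hT : Measurable T)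
    (h : α.map T = β) : W2sq α β ≤ ∫⁻ s, ‖s - T s‖ₑ ^ 2 ∂α := by
  have hm : Measurable fun s => (s, T s) := by fun_prop
  have h1 : (α.map fun s => (s, T s)).map Prod.fst = α := by
    rw [Measure.map_map (by fun_prop) hm]
    exact Measure.map_id
  have h2 : (α.map fun s => (s, T s)).map Prod.snd = β := by
    rw [Measure.map_map (by fun_prop) hm]
    exact h
  refine (iInf₂_le (α.map fun s => (s, T s)) ⟨h1, h2⟩).trans ?_
  rw [lintegral_map (by fun_prop) hm]

/-- Half the transport cost is bounded by the decrease of the potential. -/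
lemma integral_sq_sub_div_two_le [IsProbabilityMeasure α] {T : ℝ → ℝ} {K : ℝ}
    (hT : Continuous T) (hmono : Monotone T) (hK : ∀ s, |s - T s| ≤ K) (hα : Integrable id α)
    (h : α.map T = β) :
    (∫ s, (s - T s) ^ 2 ∂α) / 2 ≤ ∫ s, potential T s ∂α - ∫ s, potential T s ∂β := by
  have hc : Continuous (potential T) :=
    continuous_iff_continuousAt.2 fun s => (hasDerivAt_potential hT s).continuousAt
  have hK0 : 0 ≤ K := (abs_nonneg _).trans (hK 0)
  have hi1 : Integrable (potential T) α := by
    refine (hα.norm.const_mul K).mono' hc.aestronglyMeasurable (Eventually.of_forall fun s => ?_)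
    exact abs_potential_le hK s
  have hi2 : Integrable (fun s => potential T (T s)) α := by
    refine ((hα.norm.add (integrable_const K)).const_mul K).mono'
      (hc.comp hT).aestronglyMeasurable (Eventually.of_forall fun s => ?_)
    refine (abs_potential_le hK (T s)).trans (mul_le_mul_of_nonneg_left ?_ hK0)
    have h1 := hK s
    rw [abs_sub_comm] at h1
    have h2 := abs_add_le s (T s - s)
    rw [add_sub_cancel] at h2
    simp only [Pi.add_apply, id, Real.norm_eq_abs]
    linarith
  rw [← h, integral_map hT.aemeasurable hc.aestronglyMeasurable, ← integral_sub hi1 hi2,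
    ← integral_div]
  refine integral_mono_of_nonneg (Eventually.of_forall fun s => by positivity) (hi1.sub hi2)
    (Eventually.of_forall fun s => sq_sub_div_two_le_potential_sub hT hmono s)

lemma W2sq_self (α : Measure ℝ) : W2sq α α = 0 := by
  have := W2sq_le_lintegral_map (α := α) measurable_id Measure.map_id
  simpa using this

/-- The transport cost controls the difference of the characteristic functions. -/
lemma sq_enorm_charFun_sub_le_W2sq [IsProbabilityMeasure α] [IsProbabilityMeasure β] (t : ℝ) :
    ‖charFun α t - charFun β t‖ₑ ^ 2 ≤ ‖t‖ₑ ^ 2 * W2sq α β := by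
  unfold W2sq
  -- The factor `‖t‖ₑ ^ 2` moves inside the infimum only if it is nonzero.
  by_cases ht : t = 0
  · simp [ht]
  simp only [ENNReal.mul_iInf_of_ne (pow_ne_zero 2 (enorm_ne_zero.2 ht))
    (ENNReal.pow_ne_top enorm_ne_top)]
  refine le_iInf₂ fun γ hγ => ?_
  have hp : IsProbabilityMeasure γ := by
    refine ⟨?_⟩
    rw [← measure_univ (μ := α), ← hγ.1, Measure.map_apply measurable_fst .univ, preimage_univ]
  set e : ℝ → ℂ := fun x => Complex.exp (t * x * Complex.I) with he
  have hec : Continuous e := by fun_prop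
  have hint : ∀ f : ℝ × ℝ → ℝ, Measurable f → Integrable (fun p => e (f p)) γ := fun f hf => by
    refine Integrable.of_bound (hec.measurable.comp hf).aestronglyMeasurable 1
      (Eventually.of_forall fun p => ?_)
    rw [he]
    simp only
    rw [← Complex.ofReal_mul, Complex.norm_exp_ofReal_mul_I]
  have h1 : charFun α t - charFun β t = ∫ p, (e p.1 - e p.2) ∂γ := by
    rw [integral_sub (hint _ measurable_fst) (hint _ measurable_snd), charFun_apply_real,
      charFun_apply_real, ← hγ.1, ← hγ.2,
      integral_map measurable_fst.aemeasurable hec.aestronglyMeasurable,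
      integral_map measurable_snd.aemeasurable hec.aestronglyMeasurable]
  have h2 : ∀ p : ℝ × ℝ, ‖e p.1 - e p.2‖ₑ ≤ ‖t‖ₑ * ‖p.1 - p.2‖ₑ := fun p => by
    have h3 : e p.1 - e p.2 =
        e p.2 * (Complex.exp (Complex.I * ((t * (p.1 - p.2) : ℝ) : ℂ)) - 1) := by
      rw [he, mul_sub, mul_one]
      simp only
      rw [← Complex.exp_add]
      congr 2
      push_cast
      ring
    have h4 : ‖e p.2‖ₑ = 1 := by
      rw [he]
      simp only
      rw [← Complex.ofReal_mul, ← ofReal_norm, Complex.norm_exp_ofReal_mul_I, ENNReal.ofReal_one]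
    rw [h3, enorm_mul, h4, one_mul, ← enorm_mul]
    exact Real.enorm_exp_I_mul_ofReal_sub_one_le
  calc ‖charFun α t - charFun β t‖ₑ ^ 2
      ≤ (∫⁻ p, ‖t‖ₑ * ‖p.1 - p.2‖ₑ ∂γ) ^ 2 := by
        rw [h1]
        gcongr
        exact (enorm_integral_le_lintegral_enorm _).trans (lintegral_mono h2)
    _ = ‖t‖ₑ ^ 2 * (∫⁻ p, ‖p.1 - p.2‖ₑ ∂γ) ^ 2 := by
        rw [lintegral_const_mul _ (by fun_prop), mul_pow]
    _ ≤ ‖t‖ₑ ^ 2 * ∫⁻ p, ‖p.1 - p.2‖ₑ ^ 2 ∂γ := by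
        gcongr
        exact sq_lintegral_enorm_le (by fun_prop)

end RealLine

/-! ### One-dimensional marginals and the Poincaré inequality -/

section Projections

variable {d : ℕ}

lemma isProbabilityMeasure_uniformSphere (hd : 1 ≤ d) :
    IsProbabilityMeasure (uniformSphere d) := by
  have : NeZero d := ⟨by omega⟩
  refine ⟨?_⟩
  rw [uniformSphere, Measure.smul_apply, smul_eq_mul]
  exact ENNReal.inv_mul_cancel 
    (by simp [NeZero.ne d, (Metric.measure_ball_pos _ (0 : Space d) zero_lt_one).ne'])
    (measure_ne_top _ _)

lemma isOpenPosMeasure_uniformSphere : (uniformSphere d).IsOpenPosMeasure :=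
  Measure.isOpenPosMeasure_smul _ (ENNReal.inv_ne_zero.2 (measure_ne_top _ _))

lemma measurable_inner_sphere (θ : Sphere d) :
    Measurable fun x : Space d => inner ℝ x (θ : Space d) := by fun_prop

lemma isProbabilityMeasure_proj (σ : Measure (Space d)) [IsProbabilityMeasure σ] (θ : Sphere d) :
    IsProbabilityMeasure (proj σ θ) :=
  Measure.isProbabilityMeasure_map (measurable_inner_sphere θ).aemeasurable

/-- The fibres of `x ↦ ⟨x, θ⟩` are hyperplanes, which are Lebesgue-null. -/
lemma nullSingletonClass_proj {σ : Measure (Space d)} (hσ : σ ≪ volume) (θ : Sphere d) :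
    NullSingletonClass (proj σ θ) := by
  refine ⟨fun c => ?_⟩
  rw [proj, Measure.map_apply (measurable_inner_sphere θ) (measurableSet_singleton c)]
  refine hσ ?_
  have hθ : inner ℝ (θ : Space d) (θ : Space d) = (1 : ℝ) := by
    rw [real_inner_self_eq_norm_sq, norm_eq_of_mem_sphere θ, one_pow]
  let S : AffineSubspace ℝ (Space d) :=
    AffineSubspace.mk' (c • (θ : Space d)) (ℝ ∙ (θ : Space d))ᗮ
  have hS : S ≠ ⊤ := fun h => by
    have h1 : (θ : Space d) +ᵥ (c • (θ : Space d)) ∈ S := by rw [h]; trivial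
    rw [AffineSubspace.mem_mk', vadd_vsub, Submodule.mem_orthogonal_singleton_iff_inner_left,
      hθ] at h1
    exact one_ne_zero h1
  refine measure_mono_null (fun x hx => ?_) (Measure.addHaar_affineSubspace volume S hS)
  have hx' : inner ℝ x (θ : Space d) = c := hx
  change x ∈ S
  rw [AffineSubspace.mem_mk', Submodule.mem_orthogonal_singleton_iff_inner_left, vsub_eq_sub,
    inner_sub_left, inner_smul_left, hθ, hx']
  simp

lemma hasGradientAt_comp_inner {g : ℝ → ℝ} {g' : ℝ} {x θ : Space d}
    (h : HasDerivAt g g' (inner ℝ x θ)) :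
    HasGradientAt (fun y => g (inner ℝ y θ)) (g' • θ) x := by
  rw [hasGradientAt_iff_hasFDerivAt]
  have h1 : HasFDerivAt (fun y : Space d => inner ℝ y θ) (innerSL ℝ θ) x := by
    have : (fun y : Space d => inner ℝ y θ) = innerSL ℝ θ := by
      ext y
      rw [innerSL_apply_apply, real_inner_comm]
    rw [this]
    exact (innerSL ℝ θ).hasFDerivAt
  have h2 := h.comp_hasFDerivAt x h1
  refine h2.congr_fderiv ?_
  ext y
  simp

/-- Outside the interval the function sits at its minimum or maximum, so its derivative vanishes.
The half-open interval makes the support of the ramp's gradient a slab whose mass is a difference of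
distribution function values. -/
lemma exists_abs_deriv_smoothTransition_le :
    ∃ K : ℝ, ∀ t, |deriv Real.smoothTransition t| ≤ (Ioc 0 1).indicator (fun _ => K) t := by
  have hc : Continuous (deriv Real.smoothTransition) :=
    (Real.smoothTransition.contDiff (n := 1)).continuous_deriv_one
  obtain ⟨K, hK⟩ := isCompact_Icc.exists_bound_of_continuousOn (s := Icc (0 : ℝ) 1) hc.continuousOn
  refine ⟨K, fun t => ?_⟩
  by_cases ht : t ∈ Ioc (0 : ℝ) 1
  · rw [indicator_of_mem ht]
    exact hK t (Ioc_subset_Icc_self ht)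
  · rw [indicator_of_notMem ht, abs_nonpos_iff]
    rcases le_or_gt t 0 with h | h
    · refine IsLocalMin.deriv_eq_zero (Eventually.of_forall fun s => ?_)
      rw [Real.smoothTransition.zero_of_nonpos h]
      exact Real.smoothTransition.nonneg s
    · have h1 : 1 < t := by
        by_contra! h1
        exact ht ⟨h, h1⟩
      refine IsLocalMax.deriv_eq_zero (Eventually.of_forall fun s => ?_)
      rw [Real.smoothTransition.one_of_one_le h1.le]
      exact Real.smoothTransition.le_one s

lemma sq_fieldNorm (σ : Measure (Space d)) (v : Space d → Space d) :
    fieldNorm σ v ^ 2 = ∫⁻ x, ‖v x‖ₑ ^ 2 ∂σ := by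
  have h6 := eLpNorm_nnreal_pow_eq_lintegral (f := v) (μ := σ) (p := 2) (by norm_num)
  have h7 : ((2 : NNReal) : ℝ) = ((2 : ℕ) : ℝ) := by norm_num
  simp only [h7, ENNReal.rpow_natCast] at h6
  exact h6

lemma cdf_proj (σ : Measure (Space d)) [IsProbabilityMeasure σ] (θ : Sphere d) (a : ℝ) :
    cdf (proj σ θ) a = σ.real {x | inner ℝ x (θ : Space d) ≤ a} := by
  have := isProbabilityMeasure_proj σ θ
  rw [cdf_eq_real, proj, map_measureReal_apply (measurable_inner_sphere θ) measurableSet_Iic]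
  rfl

/-- The variance of a function equal to `0` on `A` and to `1` on `B`. -/
lemma ofReal_mul_le_evariance {Ω : Type*} [MeasurableSpace Ω] {P : Measure Ω}
    [IsProbabilityMeasure P] {f : Ω → ℝ} {A B : Set Ω} (hA : MeasurableSet A)
    (hB : MeasurableSet B) (hAB : Disjoint A B) (h0 : ∀ x ∈ A, f x = 0) (h1 : ∀ x ∈ B, f x = 1) :
    ENNReal.ofReal (P.real A * P.real B) ≤ evariance f P := by
  -- The estimate holds for every real `c`, so it covers the default value 0 when `f` is not
  -- integrable.
  set c := ∫ x, f x ∂P with hc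
  have hsum : P.real A + P.real B ≤ 1 := by
    rw [← measureReal_union hAB hB]
    exact measureReal_le_one
  set p := P.real A with hp
  set q := P.real B with hq
  have hp0 : 0 ≤ p := measureReal_nonneg
  have hq0 : 0 ≤ q := measureReal_nonneg
  have h2 : p * q ≤ c ^ 2 * p + (1 - c) ^ 2 * q := by
    have h3 : 0 ≤ c ^ 2 * p + (1 - c) ^ 2 * q := by positivity
    -- `(p + q)(c² p + (1 - c)² q) - p q = (p c - q (1 - c))²`, and `p + q ≤ 1`.
    nlinarith [sq_nonneg (p * c - q * (1 - c))]
  calc ENNReal.ofReal (p * q)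
      ≤ ENNReal.ofReal (c ^ 2 * p + (1 - c) ^ 2 * q) := ENNReal.ofReal_le_ofReal h2
    _ = ENNReal.ofReal (c ^ 2) * P A + ENNReal.ofReal ((1 - c) ^ 2) * P B := by
        rw [ENNReal.ofReal_add (by positivity) (by positivity),
          ENNReal.ofReal_mul (sq_nonneg _), ENNReal.ofReal_mul (sq_nonneg _), hp, hq,
          ofReal_measureReal, ofReal_measureReal]
    _ = ∫⁻ x in A, ENNReal.ofReal (c ^ 2) ∂P + ∫⁻ x in B, ENNReal.ofReal ((1 - c) ^ 2) ∂P := by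
        rw [setLIntegral_const, setLIntegral_const]
    _ = ∫⁻ x in A, ‖f x - c‖ₑ ^ 2 ∂P + ∫⁻ x in B, ‖f x - c‖ₑ ^ 2 ∂P := by
        congr 1
        · refine setLIntegral_congr_fun hA fun x hx => ?_
          rw [h0 x hx, Real.enorm_eq_ofReal_abs, ← ENNReal.ofReal_pow (abs_nonneg _), sq_abs]
          simp
        · refine setLIntegral_congr_fun hB fun x hx => ?_
          rw [h1 x hx, Real.enorm_eq_ofReal_abs, ← ENNReal.ofReal_pow (abs_nonneg _), sq_abs]
    _ = ∫⁻ x in A ∪ B, ‖f x - c‖ₑ ^ 2 ∂P := (lintegral_union hB hAB).symm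
    _ ≤ evariance f P := setLIntegral_le_lintegral _ _

/-- A Poincaré inequality forbids gaps in the one-dimensional marginals. -/
lemma SatisfiesPoincare.exists_gap {ν : Measure (Space d)} [IsProbabilityMeasure ν] {C : ℝ}
    (hC : 0 ≤ C) (hP : SatisfiesPoincare ν C) :
    ∃ D : ℝ, 0 ≤ D ∧ ∀ (θ : Sphere d) (a b : ℝ), a < b →
      cdf (proj ν θ) a * (1 - cdf (proj ν θ) b) * (b - a) ^ 2 ≤
        D * (cdf (proj ν θ) b - cdf (proj ν θ) a) := by
  obtain ⟨K, hK⟩ := exists_abs_deriv_smoothTransition_le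
  -- The ramp has slope at most `K / (b - a)`, which produces `K²` and the factor `(b - a)²`,
  -- uniformly in `θ`.
  refine ⟨C * K ^ 2, by positivity, fun θ a b hab => ?_⟩
  have hL : 0 < b - a := sub_pos.2 hab
  have := isProbabilityMeasure_proj ν θ
  set g : ℝ → ℝ := fun t => Real.smoothTransition ((t - a) / (b - a)) with hg
  set f : Space d → ℝ := fun x => g (inner ℝ x (θ : Space d)) with hf
  have hfc : ContDiff ℝ 1 f := by
    have h1 : ContDiff ℝ 1 fun x : Space d => (inner ℝ x (θ : Space d) - a) / (b - a) :=
      ((contDiff_id.inner ℝ contDiff_const).sub contDiff_const).div_const _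
    exact Real.smoothTransition.contDiff.comp h1
  have hgrad : ∀ x, gradient f x =
      (deriv Real.smoothTransition ((inner ℝ x (θ : Space d) - a) / (b - a)) * (1 / (b - a))) •
        (θ : Space d) := fun x => by
    refine (hasGradientAt_comp_inner (g := g) ?_).gradient
    have h1 : HasDerivAt (fun t : ℝ => (t - a) / (b - a)) (1 / (b - a))
        (inner ℝ x (θ : Space d)) := ((hasDerivAt_id _).sub_const a).div_const _
    have h2 := (Real.smoothTransition.contDiff (n := 1)).differentiable one_ne_zero
    exact (h2 _).hasDerivAt.comp _ h1
  set S : Set (Space d) := (fun x => inner ℝ x (θ : Space d)) ⁻¹' Ioc a b with hS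
  have hSm : MeasurableSet S := measurable_inner_sphere θ measurableSet_Ioc
  have hbound : ∀ x, ‖gradient f x‖ₑ ^ 2 ≤
      S.indicator (fun _ => ENNReal.ofReal ((K / (b - a)) ^ 2)) x := fun x => by
    rw [hgrad x, enorm_smul, ← ofReal_norm (θ : Space d), norm_eq_of_mem_sphere θ,
      ENNReal.ofReal_one, mul_one, Real.enorm_eq_ofReal_abs, ← ENNReal.ofReal_pow (abs_nonneg _),
      abs_mul, abs_of_pos (show 0 < 1 / (b - a) by positivity)]
    have h1 := hK ((inner ℝ x (θ : Space d) - a) / (b - a))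
    by_cases hx : x ∈ S
    · rw [indicator_of_mem hx]
      refine ENNReal.ofReal_le_ofReal ?_
      have h2 : (inner ℝ x (θ : Space d) - a) / (b - a) ∈ Ioc (0 : ℝ) 1 :=
        ⟨div_pos (sub_pos.2 hx.1) hL, (div_le_one hL).2 (by linarith [hx.2])⟩
      rw [indicator_of_mem h2] at h1
      rw [div_eq_mul_one_div K]
      gcongr
    · rw [indicator_of_notMem hx]
      have h2 : (inner ℝ x (θ : Space d) - a) / (b - a) ∉ Ioc (0 : ℝ) 1 := fun h => hx
        ⟨sub_pos.1 ((div_pos_iff_of_pos_right hL).1 h.1), by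
          linarith [(div_le_one hL).1 h.2]⟩
      rw [indicator_of_notMem h2] at h1
      rw [le_antisymm h1 (abs_nonneg _)]
      simp
  have hnorm : fieldNorm ν (gradient f) ^ 2 ≤ ENNReal.ofReal ((K / (b - a)) ^ 2) * ν S := by
    rw [sq_fieldNorm]
    refine (lintegral_mono hbound).trans ?_
    rw [lintegral_indicator hSm, setLIntegral_const]
  have hvar := ofReal_mul_le_evariance (P := ν) (f := f)
    (A := {x | inner ℝ x (θ : Space d) ≤ a}) (B := {x | b < inner ℝ x (θ : Space d)})
    (measurable_inner_sphere θ measurableSet_Iic) (measurable_inner_sphere θ measurableSet_Ioi)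
    (disjoint_left.2 fun x (h1 : _ ≤ a) (h2 : b < _) => by linarith)
    (fun x (hx : _ ≤ a) => Real.smoothTransition.zero_of_nonpos
      (div_nonpos_of_nonpos_of_nonneg (by linarith) hL.le))
    (fun x (hx : b < _) => Real.smoothTransition.one_of_one_le
      ((one_le_div hL).2 (by linarith)))
  have hlt : fieldNorm ν (gradient f) ^ 2 < ∞ :=
    hnorm.trans_lt (ENNReal.mul_lt_top ENNReal.ofReal_lt_top (measure_lt_top _ _))
  have h1 := (hvar.trans (hP f hfc hlt)).trans (mul_le_mul_right hnorm _)
  rw [← ofReal_measureReal (μ := ν) (s := S), ← ENNReal.ofReal_mul (sq_nonneg _),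
    ← ENNReal.ofReal_mul hC, ENNReal.ofReal_le_ofReal_iff (by positivity)] at h1
  have e1 : ν.real {x | b < inner ℝ x (θ : Space d)} = 1 - cdf (proj ν θ) b := by
    rw [one_sub_cdf, proj, map_measureReal_apply (measurable_inner_sphere θ) measurableSet_Ioi]
    rfl
  have e2 : ν.real S = cdf (proj ν θ) b - cdf (proj ν θ) a := by
    rw [cdf_sub_cdf hab.le, proj,
      map_measureReal_apply (measurable_inner_sphere θ) measurableSet_Ioc]
  rw [← cdf_proj, e1, e2] at h1
  calc _ ≤ C * ((K / (b - a)) ^ 2 * (cdf (proj ν θ) b - cdf (proj ν θ) a)) * (b - a) ^ 2 := by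
        gcongr
    _ = _ := by
        field_simp

lemma IsBoundedBy.one_le {ν σ : Measure (Space d)} [IsProbabilityMeasure ν] {m M : ℝ}
    (h : IsBoundedBy ν m M σ) : 1 ≤ M := by
  have := h.isProbabilityMeasure
  have h1 := h.upper univ
  simpa using h1

lemma IsBoundedBy.le_one {ν σ : Measure (Space d)} [IsProbabilityMeasure ν] {m M : ℝ}
    (h : IsBoundedBy ν m M σ) : m ≤ 1 := by
  have := h.isProbabilityMeasure
  have h1 := h.lower univ
  simpa using h1

lemma IsBoundedBy.absolutelyContinuous {ν σ : Measure (Space d)} {m M : ℝ}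
    (h : IsBoundedBy ν m M σ) : σ ≪ ν :=
  (Measure.absolutelyContinuous_of_le h.upper).trans Measure.smul_absolutelyContinuous

lemma IsBoundedBy.comparableCdf {ν σ : Measure (Space d)} (hν : IsP2ac ν) {m M D : ℝ}
    (hm : 0 < m) (h : IsBoundedBy ν m M σ) (θ : Sphere d)
    (gap : ∀ a b, a < b → cdf (proj ν θ) a * (1 - cdf (proj ν θ) b) * (b - a) ^ 2 ≤
      D * (cdf (proj ν θ) b - cdf (proj ν θ) a)) :
    ComparableCdf (cdf (proj ν θ)) m M D (cdf (proj σ θ)) := by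
  have := hν.isProbabilityMeasure
  have := h.isProbabilityMeasure
  have := isProbabilityMeasure_proj ν θ
  have := isProbabilityMeasure_proj σ θ
  have := nullSingletonClass_proj (h.absolutelyContinuous.trans hν.absolutelyContinuous) θ
  refine comparableCdf_cdf hm.le (by linarith [h.one_le]) ?_ ?_ gap
  · rw [proj, ← Measure.map_smul]
    exact Measure.map_mono h.lower (measurable_inner_sphere θ)
  · rw [proj, proj, ← Measure.map_smul]
    exact Measure.map_mono h.upper (measurable_inner_sphere θ)

/-- The value is the σ-measure of a section of a measurable set in the product. -/
lemma measurable_cdf_proj (σ : Measure (Space d)) [IsProbabilityMeasure σ] :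
    Measurable fun p : Sphere d × ℝ => cdf (proj σ p.1) p.2 := by
  simp_rw [cdf_proj, measureReal_def]
  have hS : MeasurableSet
      {q : (Sphere d × ℝ) × Space d | inner ℝ q.2 (q.1.1 : Space d) ≤ q.1.2} :=
    measurableSet_le (by fun_prop) (by fun_prop)
  exact (measurable_measure_prodMk_left (ν := σ) hS).ennreal_toReal

end Projections

/-! ### The averaged potential and its gradient -/

section AveragePotential

variable {d : ℕ}

/-- A measurable family of continuous maps of the line with displacement at most `K`. -/
structure IsTransportFamily (K : ℝ) (T : Sphere d → ℝ → ℝ) : Prop where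
  measurable : Measurable fun p : Sphere d × ℝ => T p.1 p.2
  continuous : ∀ θ, Continuous (T θ)
  abs_sub_le : ∀ θ s, |s - T θ s| ≤ K

/-- The displacement `θ (Id - T_θ) (π_θ x)` in the direction `θ`. -/
def displacement (T : Sphere d → ℝ → ℝ) (x : Space d) (θ : Sphere d) : Space d :=
  (inner ℝ x (θ : Space d) - T θ (inner ℝ x (θ : Space d))) • (θ : Space d)

/-- The average over all directions of the one-dimensional potentials. -/
def averagePotential (T : Sphere d → ℝ → ℝ) (x : Space d) : ℝ :=
  ∫ θ, potential (T θ) (inner ℝ x (θ : Space d)) ∂(uniformSphere d)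

variable {K : ℝ} {T : Sphere d → ℝ → ℝ}

lemma norm_displacement_le (hT : IsTransportFamily K T) (x : Space d) (θ : Sphere d) :
    ‖displacement T x θ‖ ≤ K := by
  rw [displacement, norm_smul, norm_eq_of_mem_sphere θ, mul_one]
  exact hT.abs_sub_le _ _

lemma measurable_displacement (hT : IsTransportFamily K T) :
    Measurable fun p : Space d × Sphere d => displacement T p.1 p.2 := by
  have h1 : Measurable fun p : Space d × Sphere d => inner ℝ p.1 (p.2 : Space d) := by fun_prop
  have h2 : Measurable fun p : Space d × Sphere d => T p.2 (inner ℝ p.1 (p.2 : Space d)) :=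
    hT.measurable.comp (measurable_snd.prodMk h1)
  exact (h1.sub h2).smul (by fun_prop)

lemma continuous_displacement (hT : IsTransportFamily K T) (θ : Sphere d) :
    Continuous fun x => displacement T x θ := by
  have h1 : Continuous fun x : Space d => inner ℝ x (θ : Space d) := by fun_prop
  exact (h1.sub ((hT.continuous θ).comp h1)).smul continuous_const

lemma measurable_potential (hT : IsTransportFamily K T) :
    Measurable fun p : Sphere d × ℝ => potential (T p.1) p.2 := by
  have h1 : Measurable fun q : (Sphere d × ℝ) × ℝ => q.2 * q.1.2 - T q.1.1 (q.2 * q.1.2) := by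
    have h2 : Measurable fun q : (Sphere d × ℝ) × ℝ => q.2 * q.1.2 := by fun_prop
    exact h2.sub (hT.measurable.comp (measurable_fst.fst.prodMk h2))
  -- Rescaling to the fixed interval `[0, 1]` makes the potential a parametric integral, hence
  -- jointly measurable.
  simp only [potential, intervalIntegral.integral_of_le (zero_le_one' ℝ)]
  exact measurable_snd.mul (h1.stronglyMeasurable.integral_prod_right').measurable

lemma measurable_potential_inner (hT : IsTransportFamily K T) :
    Measurable fun p : Space d × Sphere d => potential (T p.2) (inner ℝ p.1 (p.2 : Space d)) := by
  have h1 : Measurable fun p : Space d × Sphere d => inner ℝ p.1 (p.2 : Space d) := by fun_prop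
  exact (measurable_potential hT).comp (measurable_snd.prodMk h1)

lemma abs_potential_inner_le (hK : 0 ≤ K) (hT : IsTransportFamily K T) (x : Space d)
    (θ : Sphere d) : |potential (T θ) (inner ℝ x (θ : Space d))| ≤ K * ‖x‖ := by
  refine (abs_potential_le (hT.abs_sub_le θ) _).trans (mul_le_mul_of_nonneg_left ?_ hK)
  simpa [norm_eq_of_mem_sphere θ] using abs_real_inner_le_norm x (θ : Space d)

lemma integral_potential_proj {ρ : Measure (Space d)} (hT : IsTransportFamily K T)
    (θ : Sphere d) :
    ∫ s, potential (T θ) s ∂(proj ρ θ) =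
      ∫ x, potential (T θ) (inner ℝ x (θ : Space d)) ∂ρ := by
  have h : Measurable (potential (T θ)) := (measurable_potential hT).comp measurable_prodMk_left
  rw [proj, integral_map (measurable_inner_sphere θ).aemeasurable h.aestronglyMeasurable]

variable [IsProbabilityMeasure (uniformSphere d)]

lemma integrable_displacement (hT : IsTransportFamily K T) (x : Space d) :
    Integrable (displacement T x) (uniformSphere d) :=
  Integrable.of_bound ((measurable_displacement hT).comp measurable_prodMk_left).aestronglyMeasurable
    K (Eventually.of_forall fun θ => norm_displacement_le hT x θ)

lemma continuous_integral_displacement (hT : IsTransportFamily K T) :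
    Continuous fun x => ∫ θ, displacement T x θ ∂(uniformSphere d) :=
  continuous_of_dominated (bound := fun _ => K)
    (fun x => (integrable_displacement hT x).aestronglyMeasurable)
    (fun x => Eventually.of_forall fun θ => norm_displacement_le hT x θ) (integrable_const K)
    (Eventually.of_forall fun θ => continuous_displacement hT θ)

lemma norm_integral_displacement_le (hT : IsTransportFamily K T) (x : Space d) :
    ‖∫ θ, displacement T x θ ∂(uniformSphere d)‖ ≤ K := by
  simpa using norm_integral_le_of_norm_le_const (μ := uniformSphere d)
    (Eventually.of_forall fun θ => norm_displacement_le hT x θ)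

lemma integrable_potential_inner (hK : 0 ≤ K) (hT : IsTransportFamily K T) (x : Space d) :
    Integrable (fun θ : Sphere d => potential (T θ) (inner ℝ x (θ : Space d)))
      (uniformSphere d) :=
  Integrable.of_bound
    ((measurable_potential_inner hT).comp measurable_prodMk_left).aestronglyMeasurable
    (K * ‖x‖) (Eventually.of_forall fun θ => abs_potential_inner_le hK hT x θ)

/-- Differentiation under the integral is allowed because the gradients of the slices are bounded by
`K` uniformly in the point and the direction; this is what the truncation provides. -/
lemma hasGradientAt_averagePotential (hK : 0 ≤ K) (hT : IsTransportFamily K T) (x : Space d) :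
    HasGradientAt (averagePotential T) (∫ θ, displacement T x θ ∂(uniformSphere d)) x := by
  have hmeas : AEStronglyMeasurable
      (fun θ => InnerProductSpace.toDual ℝ (Space d) (displacement T x θ)) (uniformSphere d) :=
    (InnerProductSpace.toDual ℝ (Space d)).continuous.comp_aestronglyMeasurable
      (integrable_displacement hT x).aestronglyMeasurable
  have hint : Integrable
      (fun θ => InnerProductSpace.toDual ℝ (Space d) (displacement T x θ)) (uniformSphere d) :=
    Integrable.of_bound hmeas K (Eventually.of_forall fun θ => by
      rw [LinearIsometryEquiv.norm_map]
      exact norm_displacement_le hT x θ)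
  have h := hasFDerivAt_integral_of_dominated_of_fderiv_le (𝕜 := ℝ) (μ := uniformSphere d)
    (F := fun x (θ : Sphere d) => potential (T θ) (inner ℝ x (θ : Space d)))
    (F' := fun x θ => InnerProductSpace.toDual ℝ (Space d) (displacement T x θ))
    (bound := fun _ => K) (x₀ := x) univ_mem
    (Eventually.of_forall fun y => (integrable_potential_inner hK hT y).aestronglyMeasurable)
    (integrable_potential_inner hK hT x) hmeas
    (Eventually.of_forall fun θ y _ => by
      rw [LinearIsometryEquiv.norm_map]
      exact norm_displacement_le hT y θ)
    (integrable_const K)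
    (Eventually.of_forall fun θ y _ => hasGradientAt_iff_hasFDerivAt.1
      (hasGradientAt_comp_inner (hasDerivAt_potential (hT.continuous θ) _)))
  rw [hasGradientAt_iff_hasFDerivAt]
  refine h.congr_fderiv ?_
  ext1 y
  rw [ContinuousLinearMap.integral_apply hint, InnerProductSpace.toDual_apply_apply,
    real_inner_comm, ← integral_inner (integrable_displacement hT x)]
  simp only [InnerProductSpace.toDual_apply_apply]
  exact integral_congr_ae (Eventually.of_forall fun θ => real_inner_comm _ _)

lemma contDiff_averagePotential (hK : 0 ≤ K) (hT : IsTransportFamily K T) :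
    ContDiff ℝ 1 (averagePotential T) := by
  have h := fun x => hasGradientAt_iff_hasFDerivAt.1 (hasGradientAt_averagePotential hK hT x)
  refine contDiff_one_iff_fderiv.2 ⟨fun x => (h x).differentiableAt, ?_⟩
  rw [funext fun x => (h x).fderiv]
  exact (InnerProductSpace.toDual ℝ (Space d)).continuous.comp
    (continuous_integral_displacement hT)

lemma gradient_averagePotential (hK : 0 ≤ K) (hT : IsTransportFamily K T) :
    gradient (averagePotential T) = fun x => ∫ θ, displacement T x θ ∂(uniformSphere d) :=
  gradient_eq fun x => hasGradientAt_averagePotential hK hT x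

variable {ρ : Measure (Space d)}

lemma integrable_potential_inner_prod (hK : 0 ≤ K) (hT : IsTransportFamily K T)
    (hρ : Integrable id ρ) :
    Integrable (fun p : Space d × Sphere d => potential (T p.2) (inner ℝ p.1 (p.2 : Space d)))
      (ρ.prod (uniformSphere d)) :=
  ((hρ.comp_fst (uniformSphere d)).norm.const_mul K).mono'
    (measurable_potential_inner hT).aestronglyMeasurable
    (Eventually.of_forall fun p => abs_potential_inner_le hK hT p.1 p.2)

lemma integrable_averagePotential (hK : 0 ≤ K) (hT : IsTransportFamily K T)
    (hρ : Integrable id ρ) : Integrable (averagePotential T) ρ :=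
  (integrable_potential_inner_prod hK hT hρ).integral_prod_left

variable [SFinite ρ]

lemma integrable_integral_potential_proj (hK : 0 ≤ K) (hT : IsTransportFamily K T)
    (hρ : Integrable id ρ) :
    Integrable (fun θ => ∫ s, potential (T θ) s ∂(proj ρ θ)) (uniformSphere d) := by
  simp_rw [integral_potential_proj hT]
  exact (integrable_potential_inner_prod hK hT hρ).integral_prod_right

lemma integral_integral_potential_proj (hK : 0 ≤ K) (hT : IsTransportFamily K T)
    (hρ : Integrable id ρ) :
    ∫ θ, ∫ s, potential (T θ) s ∂(proj ρ θ) ∂(uniformSphere d) =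
      ∫ x, averagePotential T x ∂ρ := by
  simp_rw [integral_potential_proj hT]
  exact (integral_integral_swap (integrable_potential_inner_prod hK hT hρ)).symm

end AveragePotential

/-! ### Transport families of marginals and gradient domination -/

section Gradient

variable {d : ℕ}

/-- The family of the monotone maps between the one-dimensional marginals of `σ` and `μ`. -/
def marginalTransport (K : ℝ) (μ σ : Measure (Space d)) (θ : Sphere d) : ℝ → ℝ :=
  transport K (cdf (proj σ θ)) (cdf (proj μ θ))

variable {ν μ σ : Measure (Space d)} {m M D K : ℝ}

/-- The set defining the infimum is upward closed, so a witness may be moved right to a rational.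
Sublevel sets thus become countable unions, which gives joint measurability in `θ` and `s`. -/
lemma exists_rat_rawTransport_lt_iff {N F G : ℝ → ℝ} (hm : 0 < m) (hM : 0 < M)
    (hF : ComparableCdf N m M D F) (hG : ComparableCdf N m M D G) {s t : ℝ} :
    rawTransport F G s < t ↔ ∃ q : ℚ, (q : ℝ) < t ∧ 0 < G q ∧ F s ≤ G q := by
  rw [rawTransport_lt_iff hm hM hF hG]
  refine ⟨fun ⟨t', h, h'⟩ => ?_, fun ⟨q, h, h'⟩ => ⟨q, h, h'⟩⟩
  obtain ⟨q, hq, hqt⟩ := exists_rat_btwn h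
  exact ⟨q, hqt, mem_transportSet_of_le hG.mono h' hq.le⟩

lemma isTransportFamily_marginalTransport [IsProbabilityMeasure μ] [IsProbabilityMeasure σ]
    (hK : 0 ≤ K) (hm : 0 < m) (hM : 0 < M) (hD : 0 ≤ D) {N : Sphere d → ℝ → ℝ}
    (hF : ∀ θ, ComparableCdf (N θ) m M D (cdf (proj σ θ)))
    (hG : ∀ θ, ComparableCdf (N θ) m M D (cdf (proj μ θ))) :
    IsTransportFamily K (marginalTransport K μ σ) := by
  refine ⟨?_, fun θ => continuous_transport K hm hM hD (hF θ) (hG θ),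
    fun θ => abs_sub_transport_le hK _ _⟩
  have h : Measurable fun p : Sphere d × ℝ =>
      rawTransport (cdf (proj σ p.1)) (cdf (proj μ p.1)) p.2 := by
    refine measurable_of_Iio fun t => ?_
    have hS : (fun p : Sphere d × ℝ =>
        rawTransport (cdf (proj σ p.1)) (cdf (proj μ p.1)) p.2) ⁻¹' Iio t =
        ⋃ q : ℚ, {p | (q : ℝ) < t ∧ 0 < cdf (proj μ p.1) q ∧
          cdf (proj σ p.1) p.2 ≤ cdf (proj μ p.1) q} := by
      ext p
      rw [mem_preimage, mem_Iio, exists_rat_rawTransport_lt_iff hm hM (hF p.1) (hG p.1)]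
      simp
    rw [hS]
    refine MeasurableSet.iUnion fun q => ?_
    have hq : Measurable fun p : Sphere d × ℝ => cdf (proj μ p.1) q :=
      (measurable_cdf_proj μ).comp (measurable_fst.prodMk measurable_const)
    exact (MeasurableSet.const _).inter ((measurableSet_lt measurable_const hq).inter
      (measurableSet_le (measurable_cdf_proj σ) hq))
  unfold marginalTransport transport
  fun_prop

/-- For each fixed `θ` this is the one-dimensional statement; Fubini exchanges the two quantifiers.
-/
lemma ae_ae_cdf_proj_mem_Ioo [IsProbabilityMeasure (uniformSphere d)] [IsProbabilityMeasure σ]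
    (hσ : σ ≪ volume) : ∀ᵐ x ∂σ, ∀ᵐ θ ∂(uniformSphere d),
      cdf (proj σ θ) (inner ℝ x (θ : Space d)) ∈ Ioo 0 1 := by
  have h1 : Measurable fun p : Space d × Sphere d =>
      cdf (proj σ p.2) (inner ℝ p.1 (p.2 : Space d)) := by
    have h2 : Measurable fun p : Space d × Sphere d => inner ℝ p.1 (p.2 : Space d) := by fun_prop
    exact Measurable.comp (g := fun q : Sphere d × ℝ => cdf (proj σ q.1) q.2)
      (f := fun p : Space d × Sphere d => (p.2, inner ℝ p.1 (p.2 : Space d)))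
      (measurable_cdf_proj σ) (measurable_snd.prodMk h2)
  have hS : MeasurableSet {p : Space d × Sphere d |
      cdf (proj σ p.2) (inner ℝ p.1 (p.2 : Space d)) ∈ Ioo 0 1} := h1 measurableSet_Ioo
  refine (Measure.ae_ae_comm (p := fun (x : Space d) (θ : Sphere d) =>
    cdf (proj σ θ) (inner ℝ x (θ : Space d)) ∈ Ioo 0 1) hS).2 (Eventually.of_forall fun θ => ?_)
  have := isProbabilityMeasure_proj σ θ
  have := nullSingletonClass_proj hσ θ
  exact ae_of_ae_map (measurable_inner_sphere θ).aemeasurable (ae_cdf_mem_Ioo (proj σ θ))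

lemma sliceGrad_eq_displacement (hm : 0 < m) (hM : 0 < M) (hD : 0 ≤ D) {N : ℝ → ℝ}
    {θ : Sphere d} (hF : ComparableCdf N m M D (cdf (proj σ θ)))
    (hG : ComparableCdf N m M D (cdf (proj μ θ))) {x : Space d}
    (hx : cdf (proj σ θ) (inner ℝ x (θ : Space d)) ∈ Ioo 0 1) :
    sliceGrad μ σ x θ =
      displacement (marginalTransport (displacementBound m M D) μ σ) x θ := by
  rw [sliceGrad, displacement, marginalTransport,
    transport_eq_rawTransport hm hM hD hF hG hx.1 hx.2, otMap_eq_rawTransport hx.1]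

/-- The objective is bounded by the decrease of the averaged potential. -/
lemma loss_le_integral_averagePotential_sub [IsProbabilityMeasure (uniformSphere d)]
    [IsProbabilityMeasure μ] [IsProbabilityMeasure σ] (hσ : σ ≪ volume)
    (hm : 0 < m) (hM : 0 < M) (hD : 0 ≤ D) {N : Sphere d → ℝ → ℝ}
    (hF : ∀ θ, ComparableCdf (N θ) m M D (cdf (proj σ θ)))
    (hG : ∀ θ, ComparableCdf (N θ) m M D (cdf (proj μ θ)))
    (hiσ : Integrable id σ) (hiμ : Integrable id μ) {T : Sphere d → ℝ → ℝ}
    (hT : T = marginalTransport (displacementBound m M D) μ σ) :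
    loss μ σ ≤ d * ENNReal.ofReal
      (∫ x, averagePotential T x ∂σ - ∫ x, averagePotential T x ∂μ) := by
  set K := displacementBound m M D with hKdef
  have hK : 0 ≤ K := displacementBound_nonneg m M D
  have hfam : IsTransportFamily K T := by
    rw [hT]
    exact isTransportFamily_marginalTransport hK hm hM hD hF hG
  set B : Sphere d → ℝ := fun θ =>
    ∫ s, potential (T θ) s ∂(proj σ θ) - ∫ s, potential (T θ) s ∂(proj μ θ) with hB
  have hW : ∀ θ, 0 ≤ B θ ∧ W2sq (proj σ θ) (proj μ θ) ≤ ENNReal.ofReal (2 * B θ) := fun θ => by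
    have := isProbabilityMeasure_proj σ θ
    have := isProbabilityMeasure_proj μ θ
    have := nullSingletonClass_proj hσ θ
    have hmap : (proj σ θ).map (T θ) = proj μ θ := by
      rw [hT]
      exact map_transport hm hM hD (hF θ) (hG θ)
    have hmono : Monotone (T θ) := by
      rw [hT]
      exact monotone_transport K hm hM (hF θ) (hG θ)
    have hi : Integrable id (proj σ θ) := by
      rw [proj, integrable_map_measure aestronglyMeasurable_id
        (measurable_inner_sphere θ).aemeasurable]
      refine hiσ.norm.mono' (measurable_inner_sphere θ).aestronglyMeasurable
        (Eventually.of_forall fun x => ?_)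
      simpa [norm_eq_of_mem_sphere θ] using norm_inner_le_norm (𝕜 := ℝ) x (θ : Space d)
    have h1 := integral_sq_sub_div_two_le (hfam.continuous θ) hmono (hfam.abs_sub_le θ) hi hmap
    have h2 : 0 ≤ ∫ s, (s - T θ s) ^ 2 ∂(proj σ θ) := integral_nonneg fun s => sq_nonneg _
    refine ⟨by linarith, (W2sq_le_lintegral_map (hfam.continuous θ).measurable hmap).trans ?_⟩
    have hmeas : AEStronglyMeasurable (fun s => (s - T θ s) ^ 2) (proj σ θ) :=
      ((continuous_id.sub (hfam.continuous θ)).pow 2).aestronglyMeasurable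
    have h3 : Integrable (fun s => (s - T θ s) ^ 2) (proj σ θ) :=
      Integrable.of_bound hmeas (K ^ 2) (Eventually.of_forall fun s => by
        rw [norm_pow, Real.norm_eq_abs]
        exact pow_le_pow_left₀ (abs_nonneg _) (hfam.abs_sub_le θ s) 2)
    have h4 : ∫⁻ s, ‖s - T θ s‖ₑ ^ 2 ∂(proj σ θ) =
        ENNReal.ofReal (∫ s, (s - T θ s) ^ 2 ∂(proj σ θ)) := by
      rw [ofReal_integral_eq_lintegral_ofReal h3 (Eventually.of_forall fun s => sq_nonneg _)]
      refine lintegral_congr fun s => ?_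
      rw [Real.enorm_eq_ofReal_abs, ← ENNReal.ofReal_pow (abs_nonneg _), sq_abs]
    rw [h4]
    exact ENNReal.ofReal_le_ofReal (by linarith)
  have hBi : Integrable B (uniformSphere d) :=
    (integrable_integral_potential_proj hK hfam hiσ).sub
      (integrable_integral_potential_proj hK hfam hiμ)
  have hBint : ∫ θ, B θ ∂(uniformSphere d) =
      ∫ x, averagePotential T x ∂σ - ∫ x, averagePotential T x ∂μ := by
    rw [integral_sub (integrable_integral_potential_proj hK hfam hiσ)
      (integrable_integral_potential_proj hK hfam hiμ),
      integral_integral_potential_proj hK hfam hiσ, integral_integral_potential_proj hK hfam hiμ]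
  -- Monotonicity of the lower integral requires no measurability of `θ ↦ W_2²(σ^θ, μ^θ)`.
  have hSW : SW2sq σ μ ≤ 2 * ENNReal.ofReal (∫ θ, B θ ∂(uniformSphere d)) := by
    refine (lintegral_mono fun θ => (hW θ).2).trans_eq ?_
    rw [← ofReal_integral_eq_lintegral_ofReal (hBi.const_mul 2)
      (Eventually.of_forall fun θ => mul_nonneg zero_le_two (hW θ).1), integral_const_mul,
      ENNReal.ofReal_mul zero_le_two, ENNReal.ofReal_ofNat]
  rw [← hBint, loss]
  calc (d : ℝ≥0∞) / 2 * SW2sq σ μ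
      ≤ (d : ℝ≥0∞) / 2 * (2 * ENNReal.ofReal (∫ θ, B θ ∂(uniformSphere d))) := by gcongr
    _ = _ := by rw [← mul_assoc, ENNReal.div_mul_cancel two_ne_zero ENNReal.ofNat_ne_top]

/-- The mean of a function under a measure dominated by `M ν` deviates from its `ν`-mean by at most
a multiple of its standard deviation. -/
lemma IsBoundedBy.sq_lintegral_enorm_sub_le (h : IsBoundedBy ν m M σ) {f : Space d → ℝ}
    (hf : Continuous f) :
    (∫⁻ x, ‖f x - ∫ y, f y ∂ν‖ₑ ∂σ) ^ 2 ≤ ENNReal.ofReal M * evariance f ν := by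
  have := h.isProbabilityMeasure
  refine (sq_lintegral_enorm_le (by fun_prop)).trans ?_
  refine (lintegral_mono' h.upper le_rfl).trans ?_
  rw [lintegral_smul_measure, smul_eq_mul, evariance]

lemma IsBoundedBy.integrable_id (hν : IsP2ac ν) (h : IsBoundedBy ν m M σ) : Integrable id σ := by
  have := hν.isProbabilityMeasure
  have h1 : Integrable id ν := by
    refine ⟨aestronglyMeasurable_id, ?_⟩
    have h2 := (sq_lintegral_enorm_le (P := ν) (f := (id : Space d → Space d))
      aestronglyMeasurable_id).trans_lt hν.secondMoment
    exact (ENNReal.pow_lt_top_iff.1 h2).resolve_right two_ne_zero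
  exact (h1.smul_measure ENNReal.ofReal_ne_top).mono_measure h.upper

/-- Under a Poincaré inequality the difference of two means of `f` is bounded by the gradient. -/
lemma SatisfiesPoincare.ofReal_integral_sub_le (hν : IsP2ac ν) {C : ℝ} (hC : 0 ≤ C)
    (hP : SatisfiesPoincare ν C) (hm : 0 < m) (hσ : IsBoundedBy ν m M σ)
    (hμ : IsBoundedBy ν m M μ) {f : Space d → ℝ} (hf : ContDiff ℝ 1 f) (hiσ : Integrable f σ)
    (hiμ : Integrable f μ) (hfin : fieldNorm σ (gradient f) < ∞) :
    ENNReal.ofReal (∫ x, f x ∂σ - ∫ x, f x ∂μ) ≤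
      ENNReal.ofReal (2 * √C * (M / m)) * fieldNorm σ (gradient f) := by
  have := hν.isProbabilityMeasure
  have := hσ.isProbabilityMeasure
  have := hμ.isProbabilityMeasure
  have hM1 : 1 ≤ M := hσ.one_le
  have hm1 : m ≤ 1 := hσ.le_one
  set c := ∫ y, f y ∂ν with hc
  set G := fieldNorm σ (gradient f) with hG
  have h1 : fieldNorm ν (gradient f) ^ 2 ≤ ENNReal.ofReal m⁻¹ * G ^ 2 := by
    have h2 : ENNReal.ofReal m * fieldNorm ν (gradient f) ^ 2 ≤ G ^ 2 := by
      rw [hG, sq_fieldNorm, sq_fieldNorm, ← smul_eq_mul, ← lintegral_smul_measure]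
      exact lintegral_mono' hσ.lower le_rfl
    calc fieldNorm ν (gradient f) ^ 2
        = ENNReal.ofReal m⁻¹ * (ENNReal.ofReal m * fieldNorm ν (gradient f) ^ 2) := by
          rw [← mul_assoc, ← ENNReal.ofReal_mul (by positivity), inv_mul_cancel₀ hm.ne',
            ENNReal.ofReal_one, one_mul]
      _ ≤ _ := by gcongr
  have hvar : evariance f ν ≤ ENNReal.ofReal C * (ENNReal.ofReal m⁻¹ * G ^ 2) :=
    (hP f hf (h1.trans_lt (ENNReal.mul_lt_top ENNReal.ofReal_lt_top
      (ENNReal.pow_lt_top hfin)))).trans (by gcongr)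
  have key : ∀ {ρ : Measure (Space d)}, IsBoundedBy ν m M ρ →
      ∫⁻ x, ‖f x - c‖ₑ ∂ρ ≤ ENNReal.ofReal (√C * (M / m)) * G := fun {ρ} hρ => by
    refine (ENNReal.pow_le_pow_left_iff two_ne_zero).1 ?_
    refine (hρ.sq_lintegral_enorm_sub_le hf.continuous).trans ?_
    calc ENNReal.ofReal M * evariance f ν
        ≤ ENNReal.ofReal M * (ENNReal.ofReal C * (ENNReal.ofReal m⁻¹ * G ^ 2)) := by gcongr
      _ = ENNReal.ofReal (M * (C * m⁻¹)) * G ^ 2 := by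
          rw [ENNReal.ofReal_mul (by linarith), ENNReal.ofReal_mul hC]
          ring
      _ ≤ ENNReal.ofReal ((√C * (M / m)) ^ 2) * G ^ 2 := by
          gcongr
          rw [mul_pow, Real.sq_sqrt hC]
          -- The argument yields `√(C M / m)`; the stated constant follows because total masses
          -- force `m ≤ 1 ≤ M`.
          have h3 : 1 ≤ M / m := (one_le_div hm).2 (by linarith)
          calc M * (C * m⁻¹) = C * (M / m) := by ring
            _ ≤ C * (M / m) ^ 2 := by
              gcongr
              nlinarith
      _ = _ := by
          rw [ENNReal.ofReal_pow (by positivity), ← mul_pow]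
  have hsub : ∫ x, f x ∂σ - ∫ x, f x ∂μ = ∫ x, (f x - c) ∂σ - ∫ x, (f x - c) ∂μ := by
    rw [integral_sub hiσ (integrable_const c), integral_sub hiμ (integrable_const c)]
    simp
  calc ENNReal.ofReal (∫ x, f x ∂σ - ∫ x, f x ∂μ)
      ≤ ‖∫ x, (f x - c) ∂σ - ∫ x, (f x - c) ∂μ‖ₑ := by
        rw [hsub]
        exact Real.ofReal_le_enorm _
    _ ≤ ‖∫ x, (f x - c) ∂σ‖ₑ + ‖∫ x, (f x - c) ∂μ‖ₑ := enorm_sub_le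
    _ ≤ ENNReal.ofReal (√C * (M / m)) * G + ENNReal.ofReal (√C * (M / m)) * G :=
        add_le_add ((enorm_integral_le_lintegral_enorm _).trans (key hσ))
          ((enorm_integral_le_lintegral_enorm _).trans (key hμ))
    _ = _ := by
        rw [← two_mul, mul_assoc 2, ENNReal.ofReal_mul zero_le_two, ENNReal.ofReal_ofNat,
          mul_assoc]

/-! ### Separation of measures by their slices, and critical points -/

lemma charFun_proj (ρ : Measure (Space d)) (θ : Sphere d) (t : ℝ) :
    charFun (proj ρ θ) t = charFun ρ (t • (θ : Space d)) := by
  rw [charFun_apply_real, charFun_apply, proj,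
    integral_map (measurable_inner_sphere θ).aemeasurable (by fun_prop)]
  refine integral_congr_ae (Eventually.of_forall fun x => ?_)
  simp [inner_smul_right]

/-- The sliced Wasserstein distance separates probability measures. -/
lemma eq_of_SW2sq_eq_zero [IsProbabilityMeasure μ] [IsProbabilityMeasure σ]
    (h : SW2sq σ μ = 0) : σ = μ := by
  have : (uniformSphere d).IsOpenPosMeasure := isOpenPosMeasure_uniformSphere
  have hslice : ∀ (t : ℝ) (θ : Sphere d),
      charFun σ (t • (θ : Space d)) = charFun μ (t • (θ : Space d)) := fun t θ => by
    set g : Sphere d → ℂ := fun θ =>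
      charFun σ (t • (θ : Space d)) - charFun μ (t • (θ : Space d)) with hg
    have hgc : Continuous g := by fun_prop
    have h1 : ∫⁻ θ, ‖g θ‖ₑ ^ 2 ∂(uniformSphere d) = 0 := by
      refine le_antisymm ?_ zero_le
      calc ∫⁻ θ, ‖g θ‖ₑ ^ 2 ∂(uniformSphere d)
          ≤ ∫⁻ θ, ‖t‖ₑ ^ 2 * W2sq (proj σ θ) (proj μ θ) ∂(uniformSphere d) := by
            refine lintegral_mono fun θ => ?_
            have := isProbabilityMeasure_proj σ θ
            have := isProbabilityMeasure_proj μ θ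
            rw [hg]
            simp only
            rw [← charFun_proj, ← charFun_proj]
            exact sq_enorm_charFun_sub_le_W2sq t
        _ = ‖t‖ₑ ^ 2 * SW2sq σ μ :=
            lintegral_const_mul' _ _ (ENNReal.pow_ne_top enorm_ne_top)
        _ = 0 := by rw [h, mul_zero]
    rw [lintegral_eq_zero_iff (by fun_prop)] at h1
    have h2 : g =ᵐ[uniformSphere d] fun _ => 0 := by
      filter_upwards [h1] with θ hθ
      simpa using hθ
    -- Full support of the uniform distribution turns almost every direction into every direction,
    -- by continuity.
    have h3 := congrFun (hgc.ae_eq_iff_eq (uniformSphere d) continuous_const |>.1 h2) θ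
    exact sub_eq_zero.1 h3
  refine Measure.ext_of_charFun (funext fun y => ?_)
  by_cases hy : y = 0
  · simp [hy]
  · have h1 := hslice ‖y‖ ⟨‖y‖⁻¹ • y, by simp [norm_smul, hy]⟩
    simpa [smul_smul, hy] using h1

lemma loss_eq_zero_iff (hd : 1 ≤ d) [IsProbabilityMeasure μ] [IsProbabilityMeasure σ] :
    loss μ σ = 0 ↔ σ = μ := by
  refine ⟨fun h => eq_of_SW2sq_eq_zero ?_, fun h => ?_⟩
  · rw [loss, mul_eq_zero] at h
    refine h.resolve_left (ENNReal.div_ne_zero.2 ⟨?_, ENNReal.ofNat_ne_top⟩)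
    exact_mod_cast (by omega : d ≠ 0)
  · simp [loss, SW2sq, h, W2sq_self]

end Gradient

/-- At levels strictly between 0 and 1 the distribution function is strictly increasing, so the
rearrangement of a marginal to itself is the identity. -/
lemma wassersteinGrad_self_ae_eq_zero {d : ℕ} [IsProbabilityMeasure (uniformSphere d)]
    {σ : Measure (Space d)} [IsProbabilityMeasure σ] (hσ : σ ≪ volume) {m M D : ℝ} (hm : 0 < m)
    (hM : 0 < M) (hD : 0 ≤ D) {N : Sphere d → ℝ → ℝ}
    (hF : ∀ θ, ComparableCdf (N θ) m M D (cdf (proj σ θ))) :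
    wassersteinGrad σ σ =ᵐ[σ] 0 := by
  filter_upwards [ae_ae_cdf_proj_mem_Ioo hσ] with x hx
  have h : sliceGrad σ σ x =ᵐ[uniformSphere d] 0 := by
    filter_upwards [hx] with θ hθ
    rw [sliceGrad, otMap_eq_rawTransport hθ.1, rawTransport_self hm hM hD (hF θ) hθ.1 hθ.2,
      sub_self, zero_smul, Pi.zero_apply]
  rw [wassersteinGrad, integral_congr_ae h]
  simp

end SlicedOT

end

theorem mainTheorem5 (d : ℕ) (hd : 1 ≤ d)
    (ν : Measure (SlicedOT.Space d)) (hν : SlicedOT.IsP2ac ν)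
    (C : ℝ) (hC : 0 < C) (hP : SlicedOT.SatisfiesPoincare ν C)
    (m M : ℝ) (hm : 0 < m)
    (μ : Measure (SlicedOT.Space d)) (hμ : SlicedOT.IsBoundedBy ν m M μ)
    (σ : Measure (SlicedOT.Space d)) (hσ : SlicedOT.IsBoundedBy ν m M σ) :
    -- the gradient and the objective are well defined and finite
    (∀ᵐ x ∂σ, Integrable (SlicedOT.sliceGrad μ σ x) (SlicedOT.uniformSphere d)) ∧
    MemLp (SlicedOT.wassersteinGrad μ σ) 2 σ ∧
    SlicedOT.loss μ σ < ∞ ∧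
    -- gradient domination
    SlicedOT.loss μ σ ≤
      ENNReal.ofReal (2 * √C * (M / m)) *
        SlicedOT.fieldNorm σ (SlicedOT.wassersteinGrad μ σ) ∧
    -- the only critical point is `μ`
    (SlicedOT.fieldNorm σ (SlicedOT.wassersteinGrad μ σ) = 0 ↔ SlicedOT.loss μ σ = 0) ∧
    (SlicedOT.loss μ σ = 0 ↔ σ = μ) := by
  open SlicedOT in
  have hν1 := hν.isProbabilityMeasure
  have hμ1 := hμ.isProbabilityMeasure
  have hσ1 := hσ.isProbabilityMeasure
  have hU := isProbabilityMeasure_uniformSphere hd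
  have hM : 0 < M := by linarith [hσ.one_le]
  have hσv : σ ≪ volume := hσ.absolutelyContinuous.trans hν.absolutelyContinuous
  obtain ⟨D, hD, hgap⟩ := hP.exists_gap hC.le
  have hF := fun θ => hσ.comparableCdf hν hm θ (hgap θ)
  have hG := fun θ => hμ.comparableCdf hν hm θ (hgap θ)
  set K := displacementBound m M D with hKdef
  have hK : 0 ≤ K := displacementBound_nonneg m M D
  obtain ⟨T, hT⟩ : ∃ T, T = marginalTransport K μ σ := ⟨_, rfl⟩
  have hfam : IsTransportFamily K T := by
    rw [hT]
    exact isTransportFamily_marginalTransport hK hm hM hD hF hG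
  have hslice : ∀ᵐ x ∂σ, sliceGrad μ σ x =ᵐ[uniformSphere d] displacement T x := by
    filter_upwards [ae_ae_cdf_proj_mem_Ioo hσv] with x hx
    filter_upwards [hx] with θ hθ
    rw [hT]
    exact sliceGrad_eq_displacement hm hM hD (hF θ) (hG θ) hθ
  have hgrad : wassersteinGrad μ σ =ᵐ[σ] (d : ℝ) • gradient (averagePotential T) := by
    filter_upwards [hslice] with x hx
    rw [wassersteinGrad, integral_congr_ae hx, gradient_averagePotential hK hfam, Pi.smul_apply]
  have hmem : MemLp (gradient (averagePotential T)) 2 σ := by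
    rw [gradient_averagePotential hK hfam]
    exact MemLp.of_bound (continuous_integral_displacement hfam).aestronglyMeasurable K
      (Filter.Eventually.of_forall fun x => norm_integral_displacement_le hfam x)
  have hnorm : fieldNorm σ (wassersteinGrad μ σ) =
      d * fieldNorm σ (gradient (averagePotential T)) := by
    rw [fieldNorm, eLpNorm_congr_ae hgrad, eLpNorm_const_smul, fieldNorm]
    simp
  have hmemW : MemLp (wassersteinGrad μ σ) 2 σ := (hmem.const_smul (d : ℝ)).ae_eq hgrad.symm
  have hdom : loss μ σ ≤
      ENNReal.ofReal (2 * √C * (M / m)) * fieldNorm σ (wassersteinGrad μ σ) := by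
    have hiσ := hσ.integrable_id hν
    have hiμ := hμ.integrable_id hν
    refine (loss_le_integral_averagePotential_sub hσv hm hM hD hF hG hiσ hiμ hT).trans ?_
    rw [hnorm, mul_left_comm]
    gcongr
    exact hP.ofReal_integral_sub_le hν hC.le hm hσ hμ (contDiff_averagePotential hK hfam)
      (integrable_averagePotential hK hfam hiσ) (integrable_averagePotential hK hfam hiμ)
      hmem.eLpNorm_lt_top
  refine ⟨?_, hmemW, ?_, hdom, ⟨fun h => ?_, fun h => ?_⟩, loss_eq_zero_iff hd⟩
  · filter_upwards [hslice] with x hx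
    exact (integrable_displacement hfam x).congr hx.symm
  · exact hdom.trans_lt (ENNReal.mul_lt_top ENNReal.ofReal_lt_top hmemW.eLpNorm_lt_top)
  · rw [h, mul_zero] at hdom
    exact le_antisymm hdom zero_le
  -- Gradient domination says nothing in this direction; zero loss first identifies `σ` with `μ`.
  · have hσμ : σ = μ := (loss_eq_zero_iff hd).1 h
    rw [← hσμ, fieldNorm, eLpNorm_congr_ae (wassersteinGrad_self_ae_eq_zero hσv hm hM hD hF)]
    exact eLpNorm_zero
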